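/- **Conventions.** For $z\in\mathbb R^N$ let $\operatorname{supp}z=\{j: z_j\ne 0\}$ and $\Sigma_s^N=\{z\in\mathbb R^N: |\operatorname{supp}z|\le s\}$. A best $s$-term approximation of $v$ is a minimizer of $\|v-w\|_2$ over $w\in\Sigma_s^N$. *Sub-Gaussian matrices.* A random variable $\eta$ is sub-Gaussian with parameter $c>0$ if $P(|\eta|>t)\le e\,P(|\xi|>t)$ for all $t\ge 0$, where $\xi\sim\mathcal N(0,c^2)$. A random matrix is sub-Gaussian with parameter $c$, mean zero and unit variance if its entries are independent sub-Gaussian random variables with parameter $c$, mean $0$ and variance $1$. *Quantization.* For $\delta>0$ and $L\in\mathbb N$ let $Q$ map each real number to a nearest element of $\{\pm(2j+1)\delta/2: 0\le j\le L-1\}$ (ties broken in any way). The $r$th order greedy $\Sigma\Delta$ scheme maps $y\in\mathbb R^m$ to $q\in\mathbb R^m$ by $$q_i=Q\Big(\sum_{j=1}^r(-1)^{j-1}\tbinom rj u_{i-j}+y_i\Big),\qquad u_i=\sum_{j=1}^r(-1)^{j-1}\tbinom rj u_{i-j}+y_i-q_i,$$ with $u_i=0$ for $i\le 0$. *Sobolev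 dual.* Let $D$ be the $m\times m$ matrix with $D_{ii}=1$, $D_{i+1,i}=-1$ and all other entries $0$. The $r$th order Sobolev dual of a matrix $E$ with $m$ rows and full column rank is $F=(D^{-r}E)^\dagger D^{-r}$, where $A^\dagger=(A^TA)^{-1}A^T$. *Robust decoders.* The restricted isometry constant $\gamma_s(A)$ of a matrix $A\in\mathbb R^{m\times N}$ is the smallest $\gamma'$ with $(1-\gamma')\|x\|_2^2\le\|Ax\|_2^2\le(1+\gamma')\|x\|_2^2$ for all $x\in\Sigma_s^N$. For $k<m<N$, a map $\Delta:\mathbb R^{m\times N}\times\mathbb R^m\to\mathbb R^N$ is a robust compressed sensing decoder with parameters $(k,a,\gamma)$ and constant $C$ if $\|x-\Delta(A,Ax+e)\|_2\le C\varepsilon$ for all $\varepsilon>0$, all $x\in\Sigma_k^N$, all $e$ with $\|e\|_2\le\varepsilon$, and all $A$ with $\gamma_{ak}(A)<\gamma$. **Theorem.** Let $r,a\ge 1$ be integers, $0<\gamma<1$ and $c,C>0$. There are constants $C_1,C_2,C_3,C_4>0$ depending only on $r,a,\gamma,c,C$ such that the following holds. Let $0<\alpha<1$, let $1\le k<m<N$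 be integers with $$\lambda:=\frac mk\ge\big(C_1\log(eN/k)\big)^{1/(1-\alpha)},$$ let $\Phi$ be an $m\times N$ sub-Gaussian matrix with mean zero, unit variance and parameter $c$, let $\Delta$ be a robust compressed sensing decoder with parameters $(k,a,\gamma)$ and constant $C$, and let $\delta>0$, $L\in\mathbb N$, $K\in\mathbb R$ and $Q$ as above be given. Then there is an event of probability exceeding $1-4e^{-C_2m^{1-\alpha}k^\alpha}$ on which the following holds for all $z\in\Sigma_k^N$ with $|z_j|>C_3\delta$ for every $j\in\operatorname{supp}z$ and for which the number of levels is sufficient, in the sense that $L\ge\lceil B/\delta\rceil+2^r+1$ for at least one of * $B=\|\Phi z\|_\infty$, * $B=e^{1/2}\sqrt m\,\lambda^{-\alpha/2}\|z\|_2$, * $B=K\sqrt m\,\lambda^{-1/2}\|z\|_2$, provided that all entries of $\Phi$ are bounded by $K$ in absolute value almost surely. Let $T=\operatorname{supp}z$, and let $q$ be the output of the $r$th order greedy $\Sigma\Delta$ scheme for the input $\Phi z$. 1. $T$ is the support of every best $|T|$-term approximation of $\hat z=\Delta\big(\tfrac1{\sqrt m}\Phi,\tfrac1{\sqrt m}q\big)$,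 and is contained in the support of every best $k$-term approximation of $\hat z$. (So, if $|T|=k$, the support of the best $k$-term approximation is exactly $T$.) 2. Let $E$ be the submatrix of $\Phi$ formed by the columns indexed by $T$, $F$ its $r$th order Sobolev dual and $x$ the restriction of $z$ to $T$. Then $F$ is well defined with $FE=I$, and $$\|x-Fq\|_2\le C_4\,\lambda^{-\alpha(r-1/2)}\,\delta.$$ -/

import Mathlib

open MeasureTheory ProbabilityTheory
open scoped Matrix

namespace SigmaDelta

noncomputable section

/-- The Euclidean norm of a finite real vector. -/
def l2Norm {ι : Type*} [Fintype ι] (v : ι → ℝ) : ℝ := ‖WithLp.toLp 2 v‖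

/-- The support of a finite vector. -/
def supp {ι : Type*} [Fintype ι] (v : ι → ℝ) : Finset ι :=
  Finset.univ.filter fun i => v i ≠ 0

/-- `v` has at most `s` nonzero entries. -/
def IsSparse {ι : Type*} [Fintype ι] (s : ℕ) (v : ι → ℝ) : Prop := (supp v).card ≤ s

/-- `w` is a best `s`-term approximation of `v` in the Euclidean norm. -/
def IsBestTermApprox {ι : Type*} [Fintype ι] (s : ℕ) (v w : ι → ℝ) : Prop :=
  IsSparse s w ∧ ∀ w' : ι → ℝ, IsSparse s w' → l2Norm (v - w) ≤ l2Norm (v - w')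

/-! ### Sub-Gaussian matrices -/

/-- The random variable `η` is `K`-dominated by the distribution `ν` on the real line. -/
def IsDominated {Ω : Type*} [MeasurableSpace Ω] (P : Measure Ω) (η : Ω → ℝ) (K : ℝ)
    (ν : Measure ℝ) : Prop :=
  ∀ t : ℝ, 0 ≤ t → P.real {ω | t < |η ω|} ≤ K * ν.real {x | t < |x|}

/-- Sub-Gaussian with parameter `c`: `e`-dominated by `N(0, c²)`. -/
def IsSubGaussianVar {Ω : Type*} [MeasurableSpace Ω] (P : Measure Ω) (η : Ω → ℝ) (c : ℝ) : Prop :=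
  IsDominated P η (Real.exp 1) (gaussianReal 0 ⟨c ^ 2, sq_nonneg c⟩)

/-- A random matrix whose entries are independent (not necessarily identically distributed)
sub-Gaussian random variables with parameter `c`, mean `μ` and variance `v`. -/
structure IsSubGaussianMatrix {Ω : Type*} [MeasurableSpace Ω] (P : Measure Ω) {m n : ℕ}
    (A : Ω → Matrix (Fin m) (Fin n) ℝ) (c μ v : ℝ) : Prop where
  measurable : ∀ i j, Measurable fun ω => A ω i j
  indep : iIndepFun (fun (p : Fin m × Fin n) (ω : Ω) => A ω p.1 p.2) P
  subGaussian : ∀ i j, IsSubGaussianVar P (fun ω => A ω i j) c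
  mean : ∀ i j, ∫ ω, A ω i j ∂P = μ
  variance : ∀ i j, ProbabilityTheory.variance (fun ω => A ω i j) P = v

/-! ### Greedy Sigma-Delta quantization -/

/-- The `2L`-level mid-rise alphabet `{±(2j+1)δ/2 : j = 0, …, L-1}`. -/
def midRise (δ : ℝ) (L : ℕ) : Set ℝ :=
  {x | ∃ j : ℕ, j < L ∧ (x = (2 * j + 1) * δ / 2 ∨ x = -((2 * j + 1) * δ / 2))}

/-- `Q` rounds every real number to a nearest element of the `2L`-level mid-rise alphabet
(ties may be broken in any way). -/
def IsScalarQuantizer (δ : ℝ) (L : ℕ) (Q : ℝ → ℝ) : Prop :=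
  ∀ x, Q x ∈ midRise δ L ∧ ∀ a ∈ midRise δ L, |x - Q x| ≤ |x - a|

/-- The argument `v_i = ∑_{j=1}^r (-1)^{j-1} (r choose j) u_{i-j} + y_i` of the scalar quantizer
in the `r`-th order greedy scheme, where `u_l = v_l - Q v_l` is the state variable and
`u_l = 0` before the first index. The summation index below is `j - 1`. -/
def greedyArg {m : ℕ} (Q : ℝ → ℝ) (r : ℕ) (y : Fin m → ℝ) (i : Fin m) : ℝ :=
  (∑ j : Fin r,
    if h : j.1 + 1 ≤ i.1 then
      (-1 : ℝ) ^ j.1 * (r.choose (j.1 + 1) : ℝ) *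
        (greedyArg Q r y ⟨i.1 - (j.1 + 1), by omega⟩ -
          Q (greedyArg Q r y ⟨i.1 - (j.1 + 1), by omega⟩))
    else 0) + y i
termination_by i.1
decreasing_by all_goals omega

/-- The output `q_i = Q v_i` of the `r`-th order greedy Sigma-Delta scheme with input `y`. -/
def greedyQuantize {m : ℕ} (Q : ℝ → ℝ) (r : ℕ) (y : Fin m → ℝ) : Fin m → ℝ :=
  fun i => Q (greedyArg Q r y i)

/-- The number of levels `⌈B/δ⌉ + 2^r + 1` required by the `r`-th order greedy scheme with
step size `δ` for inputs bounded by `B`. -/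
def levelBound (r : ℕ) (δ B : ℝ) : ℕ := ⌈B / δ⌉₊ + 2 ^ r + 1

/-! ### Sobolev duals -/

/-- The `m × m` difference matrix: `1` on the diagonal and `-1` on the first subdiagonal. -/
def diffMatrix (m : ℕ) : Matrix (Fin m) (Fin m) ℝ :=
  Matrix.of fun i j => if i = j then 1 else if i.1 = j.1 + 1 then -1 else 0

/-- The Moore-Penrose left inverse `(AᵀA)⁻¹Aᵀ` of a matrix of full column rank. -/
def leftPinv {m : ℕ} {ι : Type*} [Fintype ι] [DecidableEq ι] (A : Matrix (Fin m) ι ℝ) :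
    Matrix ι (Fin m) ℝ :=
  (Aᵀ * A)⁻¹ * Aᵀ

/-- The `r`-th order Sobolev dual `(D⁻ʳE)† D⁻ʳ` of `E`. -/
def sobolevDual {m : ℕ} {ι : Type*} [Fintype ι] [DecidableEq ι] (r : ℕ)
    (E : Matrix (Fin m) ι ℝ) : Matrix ι (Fin m) ℝ :=
  leftPinv ((diffMatrix m ^ r)⁻¹ * E) * (diffMatrix m ^ r)⁻¹

/-- The submatrix of `A` formed by the columns indexed by `T`. -/
def columns {m N : ℕ} (A : Matrix (Fin m) (Fin N) ℝ) (T : Finset (Fin N)) :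
    Matrix (Fin m) T ℝ :=
  A.submatrix id fun j => (j : Fin N)

/-! ### Robust compressed sensing decoders -/

/-- The restricted isometry constant of order `s`: the smallest `γ` with
`(1 - γ)‖x‖² ≤ ‖Ax‖² ≤ (1 + γ)‖x‖²` for all `s`-sparse `x`. -/
def ripConst {m N : ℕ} (s : ℕ) (A : Matrix (Fin m) (Fin N) ℝ) : ℝ :=
  sInf {γ : ℝ | ∀ x : Fin N → ℝ, IsSparse s x →
    (1 - γ) * l2Norm x ^ 2 ≤ l2Norm (A *ᵥ x) ^ 2 ∧
      l2Norm (A *ᵥ x) ^ 2 ≤ (1 + γ) * l2Norm x ^ 2}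

/-- `Δ` is a robust compressed sensing decoder with parameters `(k, a, γ)` and constant `C`. -/
def IsRobustDecoder {m N : ℕ}
    (Δ : Matrix (Fin m) (Fin N) ℝ → (Fin m → ℝ) → (Fin N → ℝ))
    (k a : ℕ) (γ C : ℝ) : Prop :=
  ∀ A : Matrix (Fin m) (Fin N) ℝ, ripConst (a * k) A < γ →
    ∀ ε : ℝ, 0 < ε → ∀ x : Fin N → ℝ, IsSparse k x →
      ∀ e : Fin m → ℝ, l2Norm e ≤ ε → l2Norm (x - Δ A (A *ᵥ x + e)) ≤ C * ε

end

end SigmaDelta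

open SigmaDelta

/-! Noise shaping turns quantization into a linear relation: as long as the quantizer is never
overloaded, the state `u` satisfies `D ^ r u = Φ z - q` with entries at most `δ / 2`. Both
conclusions follow from this relation on a single good event.

Support: applying `D ^ r` costs at most `2 ^ r` in sup norm, so `q / √m` is a measurement of `z` by
`Φ / √m` with noise of norm at most `2 ^ r δ / 2`. The restricted isometry property of `Φ / √m` lets
the decoder return a vector within `θ = C 2 ^ r δ / 2` of `z`. Since nonzero entries of `z` exceed
`2θ`, the largest entries of the output sit on the support.

Accuracy: `x - F q = (D⁻ʳ E)† u`, so the error is at most `‖u‖ / σ`, where `‖u‖ ≤ √m δ / 2` and `σ`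
is a lower bound for `D⁻ʳ E`. The heart of the matter is `σ ≳ √m λ ^ (α (r - 1/2))`, uniformly over
supports.

This bound comes from testing `D ^ r u = Φ x` against a matrix `M` of `l` unit rows supported on
disjoint blocks of length `(r + 1) h`. The rows are built from a polynomial `p` for which `(1 - X) ^
r p` is small, which gives `‖M D ^ r u‖ ≲ h ^ (-r) ‖u‖` (`exists_blockAverage`). Disjointness and
normalization make `M Φ` again a matrix of independent standardized sub-Gaussian entries, so its own
restricted isometry property gives `‖M Φ x‖² ≥ (l / 2) ‖x‖²` for all sparse `x`. Hence `‖u‖ ≳ h ^ r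
√l ‖x‖`. The choice `h ≈ λ ^ α`, `l ≈ m λ ^ (-α) = m ^ (1 - α) k ^ α` yields `σ`; the requirement `l
≳ k log (eN / k)` is the hypothesis on `λ`, and the failure probability is exponential in `l`.

The restricted isometry property (`exists_rip_rate`) follows the usual route: tails, moment
generating functions, concentration of `‖A x‖²` for fixed `x`, a net on each coordinate sphere, and
a union over supports. -/

/-! ### Nets on the unit sphere -/

section Nets

open Module Metric ENNReal

variable {E : Type*} [NormedAddCommGroup E] [NormedSpace ℝ E]

/-- Volumetric bound on the size of an `ε`-separated set in the closed unit ball. -/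
theorem card_le_of_separated_unitBall [FiniteDimensional ℝ E] {ε : ℝ} (hε : 0 < ε) (s : Finset E)
    (hs : ∀ c ∈ s, ‖c‖ ≤ 1) (h : ∀ c ∈ s, ∀ d ∈ s, c ≠ d → ε ≤ ‖c - d‖) :
    (s.card : ℝ) ≤ (1 + 2 / ε) ^ finrank ℝ E := by
  borelize E
  let μ : Measure E := Measure.addHaar
  have hδ : 0 < ε / 2 := by positivity
  have hρ : 0 < 1 + ε / 2 := by positivity
  have hdisj : Set.Pairwise (s : Set E) (Function.onFun Disjoint fun c => ball c (ε / 2)) := by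
    rintro c hc d hd hcd
    apply ball_disjoint_ball
    rw [dist_eq_norm]
    convert! h c hc d hd hcd
    ring
  have hsub : (⋃ c ∈ s, ball c (ε / 2)) ⊆ ball (0 : E) (1 + ε / 2) := by
    refine Set.iUnion₂_subset fun x hx => ball_subset_ball' ?_
    rw [dist_zero_right]
    linarith [hs x hx]
  have I : (s.card : ℝ≥0∞) * ENNReal.ofReal ((ε / 2) ^ finrank ℝ E) * μ (ball 0 1) ≤
      ENNReal.ofReal ((1 + ε / 2) ^ finrank ℝ E) * μ (ball 0 1) :=
    calc
      _ = μ (⋃ c ∈ s, ball c (ε / 2)) := by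
        rw [measure_biUnion_finset hdisj fun c _ => measurableSet_ball]
        simp only [μ.addHaar_ball_of_pos _ hδ, Finset.sum_const, nsmul_eq_mul, mul_assoc]
      _ ≤ μ (ball (0 : E) (1 + ε / 2)) := measure_mono hsub
      _ = _ := by simp only [μ.addHaar_ball_of_pos _ hρ]
  have J := (ENNReal.mul_le_mul_iff_left (measure_ball_pos _ _ zero_lt_one).ne'
    measure_ball_lt_top.ne).1 I
  have K := ENNReal.toReal_le_of_le_ofReal (pow_nonneg hρ.le _) J
  rw [ENNReal.toReal_mul, ENNReal.toReal_natCast, ENNReal.toReal_ofReal (by positivity)] at K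
  have e : 1 + 2 / ε = (1 + ε / 2) / (ε / 2) := by field_simp; ring
  rw [e, div_pow, le_div_iff₀ (by positivity)]
  exact K

/-- The unit sphere has an `ε`-net of cardinality at most `(1 + 2 / ε) ^ dim`. -/
theorem exists_net_unitSphere [FiniteDimensional ℝ E] {ε : ℝ} (hε : 0 < ε) :
    ∃ s : Finset E, (∀ c ∈ s, ‖c‖ = 1) ∧ (s.card : ℝ) ≤ (1 + 2 / ε) ^ finrank ℝ E ∧
      ∀ x : E, ‖x‖ = 1 → ∃ c ∈ s, ‖x - c‖ < ε := by
  classical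
  -- The volumetric bound makes the sizes of separated sets bounded, so a largest one exists; a
  -- point far from all of it could be added, so it is a net.
  let S : Set ℕ := {n | ∃ s : Finset E, (∀ c ∈ s, ‖c‖ = 1) ∧
    (∀ c ∈ s, ∀ d ∈ s, c ≠ d → ε ≤ ‖c - d‖) ∧ s.card = n}
  have hne : S.Nonempty := ⟨0, ∅, by simp, by simp, rfl⟩
  have hbdd : BddAbove S := by
    refine ⟨⌊(1 + 2 / ε) ^ finrank ℝ E⌋₊, ?_⟩
    rintro n ⟨s, h1, h2, rfl⟩
    exact Nat.le_floor (card_le_of_separated_unitBall hε s (fun c hc => (h1 c hc).le) h2)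
  obtain ⟨s, h1, h2, h3⟩ := Nat.sSup_mem hne hbdd
  refine ⟨s, h1, card_le_of_separated_unitBall hε s (fun c hc => (h1 c hc).le) h2, ?_⟩
  intro x hx
  by_contra! hcon
  have hxs : x ∉ s := fun hxs => by
    have := hcon x hxs
    simp only [sub_self, norm_zero] at this
    linarith
  have : s.card + 1 ≤ sSup S := by
    refine le_csSup hbdd ⟨insert x s, ?_, ?_, Finset.card_insert_of_notMem hxs⟩
    · simpa [hx] using h1
    · intro c hc d hd hcd
      rcases Finset.mem_insert.1 hc with rfl | hc'
      · rcases Finset.mem_insert.1 hd with rfl | hd'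
        · exact absurd rfl hcd
        · exact hcon d hd'
      · rcases Finset.mem_insert.1 hd with rfl | hd'
        · rw [norm_sub_rev]; exact hcon c hc'
        · exact h2 c hc' d hd' hcd
  omega

/-- A linear map that is a near isometry on a net of the sphere is a near isometry. -/
theorem near_isometry_of_net {F : Type*} [NormedAddCommGroup F] [NormedSpace ℝ F]
    (B : E →L[ℝ] F) (s : Finset E) {ε t : ℝ} (hε : ε ≤ 1 / 2) (ht : t ≤ 1)
    (hnet : ∀ x : E, ‖x‖ = 1 → ∃ c ∈ s, ‖x - c‖ < ε)
    (hs : ∀ c ∈ s, |‖B c‖ - 1| ≤ t) {x : E} (hx : ‖x‖ = 1) :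
    |‖B x‖ - 1| ≤ t + 4 * ε := by
  have hε0 : 0 ≤ ε := by
    obtain ⟨c, -, h⟩ := hnet x hx
    exact (norm_nonneg _).trans h.le
  have key : ∀ y : E, ‖y‖ = 1 → |‖B y‖ - 1| ≤ t + ‖B‖ * ε := by
    intro y hy
    obtain ⟨c, hc, hyc⟩ := hnet y hy
    have h1 : |‖B y‖ - ‖B c‖| ≤ ‖B‖ * ε := by
      refine (abs_norm_sub_norm_le _ _).trans ?_
      rw [← map_sub]
      exact (B.le_opNorm _).trans (by gcongr)
    have h2 := hs c hc
    rw [abs_le] at *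
    constructor <;> linarith [h1.1, h1.2, h2.1, h2.2]
  have ht0 : 0 ≤ t := by
    obtain ⟨c, hc, -⟩ := hnet x hx
    exact (abs_nonneg _).trans (hs c hc)
  -- The net error involves the unknown `‖B‖`. Bounding `‖B‖` by itself with factor `ε ≤ 1 / 2` lets
  -- it be absorbed, leaving `‖B‖ ≤ 4`.
  have hB : ‖B‖ ≤ 1 + t + ‖B‖ * ε := by
    refine B.opNorm_le_of_unit_norm (by positivity) fun y hy => ?_
    linarith [(abs_le.1 (key y hy)).2]
  have hB4 : ‖B‖ ≤ 4 := by nlinarith [norm_nonneg B]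
  refine (key x hx).trans ?_
  gcongr

end Nets

/-! ### Square-exponential moments of sub-Gaussian variables -/

section SubGaussian

open Real
open scoped NNReal ENNReal

/-- For a centered variable the linear term integrates to zero, which reduces the moment generating
function to a square-exponential moment. -/
theorem Real.exp_le_add_exp_sq (x : ℝ) : rexp x ≤ x + rexp (x ^ 2) := by
  rcases le_or_gt 1 x with h | h
  · have : rexp x ≤ rexp (x ^ 2) := exp_le_exp.2 (by nlinarith)
    linarith
  · have h2 := add_one_le_exp (x ^ 2)
    rcases le_or_gt (-1) x with h' | h'
    · have := (abs_le.1 (abs_exp_sub_one_sub_id_le (abs_le.2 ⟨h', h.le⟩))).2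
      linarith
    · have : rexp x ≤ 1 := exp_le_one_iff.2 (by linarith)
      nlinarith

/-- The second-order Taylor remainder; it serves for centered squares, whose linear term also
integrates to zero. -/
theorem Real.exp_le_one_add_add_sq_mul_exp_abs (x : ℝ) :
    rexp x ≤ 1 + x + x ^ 2 * rexp |x| := by
  have h := Complex.norm_exp_sub_sum_le_norm_mul_exp (x : ℂ) 2
  have e : Complex.exp (x : ℂ) - ∑ m ∈ Finset.range 2, (x : ℂ) ^ m / (m.factorial : ℂ)
      = ((rexp x - (1 + x) : ℝ) : ℂ) := by
    simp [Finset.sum_range_succ]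
  rw [e, Complex.norm_real, Complex.norm_real, Real.norm_eq_abs, Real.norm_eq_abs, sq_abs] at h
  linarith [(abs_le.1 h).2]

/-- The weight `exp (g² / 4)` times the `N(0, 1)` density is `√2` times the `N(0, 2)` density. -/
theorem lintegral_exp_sq_div_four_gaussianReal :
    ∫⁻ g, ENNReal.ofReal (rexp (g ^ 2 / 4)) ∂(gaussianReal 0 1) ≤ ENNReal.ofReal (√2) := by
  rw [gaussianReal_of_var_ne_zero _ one_ne_zero,
    lintegral_withDensity_eq_lintegral_mul _ (measurable_gaussianPDF 0 1) (by fun_prop)]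
  have key : ∀ g : ℝ, (gaussianPDF 0 1 * fun g => ENNReal.ofReal (rexp (g ^ 2 / 4))) g
      = ENNReal.ofReal (√2) * gaussianPDF 0 2 g := by
    intro g
    simp only [Pi.mul_apply, gaussianPDF]
    rw [← ENNReal.ofReal_mul (gaussianPDFReal_nonneg _ _ _), ← ENNReal.ofReal_mul (by positivity)]
    congr 1
    simp only [gaussianPDFReal, NNReal.coe_one, mul_one, sub_zero, NNReal.coe_ofNat]
    have e1 : rexp (-g ^ 2 / 2) * rexp (g ^ 2 / 4) = rexp (-g ^ 2 / (2 * 2)) := by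
      rw [← Real.exp_add]; congr 1; ring
    have e2 : √(2 * π * 2) = √2 * √(2 * π) := by
      rw [← Real.sqrt_mul (by norm_num)]; congr 1; ring
    rw [mul_assoc, e1, e2, mul_inv, ← mul_assoc, ← mul_assoc, mul_inv_cancel₀ (by positivity),
      one_mul]
  rw [lintegral_congr key, lintegral_const_mul _ (measurable_gaussianPDF 0 2),
    lintegral_gaussianPDF_eq_one 0 two_ne_zero, mul_one]

variable {Ω : Type*} [MeasurableSpace Ω] {P : Measure Ω}

/-- Gaussian linearization: `exp (t² Y² / 2)` is the mean of `exp (t Y g)` over a standard Gaussian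
`g`. After exchanging the integrals the sub-Gaussian bound applies for fixed `g`; `t² = 1 / (2τ)`
leaves `exp (g² / 4)`. -/
theorem lintegral_exp_sq_le_of_hasSubgaussianMGF [IsProbabilityMeasure P] {Y : Ω → ℝ} {τ : ℝ≥0}
    (hτ : 0 < τ) (h : HasSubgaussianMGF Y τ P) :
    ∫⁻ ω, ENNReal.ofReal (rexp (Y ω ^ 2 / (4 * τ))) ∂P ≤ ENNReal.ofReal (√2) := by
  have hτ' : (0 : ℝ) < τ := hτ
  set t : ℝ := √(1 / (2 * τ)) with ht
  have ht2 : t ^ 2 = 1 / (2 * τ) := Real.sq_sqrt (by positivity)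
  have h1 : ∀ ω, ENNReal.ofReal (rexp (Y ω ^ 2 / (4 * τ)))
      = ∫⁻ g, ENNReal.ofReal (rexp ((t * Y ω) * g)) ∂(gaussianReal 0 1) := by
    intro ω
    rw [← ofReal_integral_eq_lintegral_ofReal (integrable_exp_mul_gaussianReal _)
      (ae_of_all _ fun x => (exp_pos _).le)]
    have := congrFun (mgf_fun_id_gaussianReal (μ := 0) (v := 1)) (t * Y ω)
    simp only [mgf] at this
    rw [this]
    congr 2
    simp only [zero_mul, NNReal.coe_one, one_mul, zero_add, mul_pow, ht2]
    field_simp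
    ring
  have hY := h.aemeasurable
  rw [lintegral_congr h1, lintegral_lintegral_swap]
  · refine le_trans (lintegral_mono fun g => ?_) lintegral_exp_sq_div_four_gaussianReal
    have e : ∀ ω, rexp ((t * Y ω) * g) = rexp ((t * g) * Y ω) := fun ω => by congr 1; ring
    simp only [e]
    rw [← ofReal_integral_eq_lintegral_ofReal (h.integrable_exp_mul _)
      (ae_of_all _ fun x => (exp_pos _).le)]
    refine ENNReal.ofReal_le_ofReal ((h.mgf_le (t * g)).trans (exp_le_exp.2 (le_of_eq ?_)))
    rw [mul_pow, ht2]
    field_simp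
    ring
  · have hY' : AEMeasurable (fun p : Ω × ℝ => Y p.1) (P.prod (gaussianReal 0 1)) := hY.comp_fst
    simp only [Function.uncurry_def]
    fun_prop

theorem integrable_and_integral_le_of_lintegral_ofReal_le {f : Ω → ℝ} (hf : AEMeasurable f P)
    (h0 : ∀ ω, 0 ≤ f ω) {b : ℝ} (hb : 0 ≤ b)
    (h : ∫⁻ ω, ENNReal.ofReal (f ω) ∂P ≤ ENNReal.ofReal b) :
    Integrable f P ∧ ∫ ω, f ω ∂P ≤ b := by
  constructor
  · refine ⟨hf.aestronglyMeasurable, ?_⟩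
    rw [hasFiniteIntegral_iff_ofReal (ae_of_all _ h0)]
    exact h.trans_lt ENNReal.ofReal_lt_top
  · rw [integral_eq_lintegral_of_nonneg_ae (ae_of_all _ h0) hf.aestronglyMeasurable]
    exact ENNReal.toReal_le_of_le_ofReal hb h

/-- The distribution of a sub-Gaussian variable has a finite square-exponential moment. -/
theorem lintegral_exp_sq_le_of_isSubGaussianVar [IsProbabilityMeasure P] {η : Ω → ℝ} {c : ℝ}
    (hc : 0 < c) (hη : Measurable η) (h : IsSubGaussianVar P η c) :
    ∫⁻ ω, ENNReal.ofReal (rexp (η ω ^ 2 / (4 * c ^ 2))) ∂P ≤ ENNReal.ofReal (rexp 2) := by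
  set v : ℝ≥0 := ⟨c ^ 2, sq_nonneg c⟩ with hv
  have hv0 : 0 < v := by
    rw [← NNReal.coe_pos]; exact pow_pos hc 2
  have hvc : (v : ℝ) = c ^ 2 := rfl
  have hg : HasSubgaussianMGF (fun x : ℝ => x) v (gaussianReal 0 v) := by
    refine ⟨fun t => integrable_exp_mul_gaussianReal t, fun t => ?_⟩
    rw [mgf_fun_id_gaussianReal]
    simp
  have hG := lintegral_exp_sq_le_of_hasSubgaussianMGF hv0 hg
  rw [hvc] at hG
  -- Tail domination passes to `exp (x² / (4c²))`, an increasing function of `|x|`, and the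
  -- layer-cake formula then integrates it. Levels below `1` lie outside the reach of the
  -- hypothesis, but there the Gaussian event is everything.
  have hdom : ∀ t : ℝ, P {ω | t < rexp (η ω ^ 2 / (4 * c ^ 2))} ≤
      ENNReal.ofReal (rexp 1) * (gaussianReal 0 v) {x | t < rexp (x ^ 2 / (4 * c ^ 2))} := by
    intro t
    rcases lt_or_ge t 1 with ht | ht
    · have : {x : ℝ | t < rexp (x ^ 2 / (4 * c ^ 2))} = Set.univ := by
        ext x
        simp only [Set.mem_ofPred_eq, Set.mem_univ, iff_true]
        exact ht.trans_le (one_le_exp (by positivity))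
      rw [this, measure_univ, mul_one]
      refine prob_le_one.trans ?_
      rw [← ENNReal.ofReal_one]
      exact ENNReal.ofReal_le_ofReal (one_le_exp zero_le_one)
    · have heq : ∀ x : ℝ, t < rexp (x ^ 2 / (4 * c ^ 2)) ↔ √(4 * c ^ 2 * log t) < |x| := by
        intro x
        rw [← Real.log_lt_iff_lt_exp (by linarith), lt_div_iff₀ (by positivity),
          ← Real.sqrt_sq_eq_abs, Real.sqrt_lt_sqrt_iff, mul_comm]
        have := Real.log_nonneg ht
        positivity
      simp only [heq]
      have := h (√(4 * c ^ 2 * log t)) (Real.sqrt_nonneg _)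
      rw [Measure.real, Measure.real, ← ENNReal.toReal_ofReal (exp_pos 1).le,
        ← ENNReal.toReal_mul] at this
      exact (ENNReal.toReal_le_toReal (measure_ne_top _ _)
        (ENNReal.mul_ne_top ENNReal.ofReal_ne_top (measure_ne_top _ _))).1 this
  rw [lintegral_eq_lintegral_meas_lt _ (ae_of_all _ fun x => (exp_pos _).le) (by fun_prop)] at hG ⊢
  calc _ ≤ ∫⁻ t in Set.Ioi 0, ENNReal.ofReal (rexp 1) *
        (gaussianReal 0 v) {x | t < rexp (x ^ 2 / (4 * c ^ 2))} := lintegral_mono fun t => hdom t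
    _ = ENNReal.ofReal (rexp 1) * ∫⁻ t in Set.Ioi 0,
        (gaussianReal 0 v) {x | t < rexp (x ^ 2 / (4 * c ^ 2))} :=
      lintegral_const_mul' _ _ ENNReal.ofReal_ne_top
    _ ≤ ENNReal.ofReal (rexp 1) * ENNReal.ofReal (√2) := by gcongr
    _ ≤ ENNReal.ofReal (rexp 2) := by
      rw [← ENNReal.ofReal_mul (exp_pos 1).le]
      refine ENNReal.ofReal_le_ofReal ?_
      rw [show (2 : ℝ) = 1 + 1 by norm_num, Real.exp_add]
      gcongr
      rw [Real.sqrt_le_left (exp_pos 1).le]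
      nlinarith [add_one_le_exp (1 : ℝ)]

theorem integral_exp_sq_le_of_isSubGaussianVar [IsProbabilityMeasure P] {η : Ω → ℝ} {c : ℝ}
    (hc : 0 < c) (hη : Measurable η) (h : IsSubGaussianVar P η c) :
    Integrable (fun ω => rexp (η ω ^ 2 / (4 * c ^ 2))) P ∧
      ∫ ω, rexp (η ω ^ 2 / (4 * c ^ 2)) ∂P ≤ rexp 2 :=
  integrable_and_integral_le_of_lintegral_ofReal_le (by fun_prop) (fun _ => (exp_pos _).le)
    (exp_pos _).le (lintegral_exp_sq_le_of_isSubGaussianVar hc hη h)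

theorem integral_exp_sq_le_of_hasSubgaussianMGF [IsProbabilityMeasure P] {Y : Ω → ℝ} {τ : ℝ≥0}
    (hτ : 0 < τ) (h : HasSubgaussianMGF Y τ P) :
    Integrable (fun ω => rexp (Y ω ^ 2 / (4 * τ))) P ∧
      ∫ ω, rexp (Y ω ^ 2 / (4 * τ)) ∂P ≤ 2 := by
  have hY := h.aemeasurable
  refine integrable_and_integral_le_of_lintegral_ofReal_le (by fun_prop) (fun _ => (exp_pos _).le)
    zero_le_two ((lintegral_exp_sq_le_of_hasSubgaussianMGF hτ h).trans
      (ENNReal.ofReal_le_ofReal ?_))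
  rw [Real.sqrt_le_left zero_le_two]
  norm_num

/-- A centered sub-Gaussian variable has a sub-Gaussian moment generating function. -/
theorem hasSubgaussianMGF_of_isSubGaussianVar [IsProbabilityMeasure P] {η : Ω → ℝ} {c : ℝ}
    (hc : 0 < c) (hη : Measurable η) (h : IsSubGaussianVar P η c) (h0 : ∫ ω, η ω ∂P = 0) :
    HasSubgaussianMGF η ⟨18 * c ^ 2, by positivity⟩ P := by
  obtain ⟨hint, hle⟩ := integral_exp_sq_le_of_isSubGaussianVar hc hη h
  have hbound : ∀ t ω, rexp (t * η ω) ≤ rexp (c ^ 2 * t ^ 2) * rexp (η ω ^ 2 / (4 * c ^ 2)) := by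
    intro t ω
    rw [← Real.exp_add]
    refine exp_le_exp.2 ?_
    have : c ^ 2 * t ^ 2 + η ω ^ 2 / (4 * c ^ 2) - t * η ω = (c * t - η ω / (2 * c)) ^ 2 := by
      field_simp
      ring
    nlinarith [sq_nonneg (c * t - η ω / (2 * c))]
  have hexp : ∀ t, Integrable (fun ω => rexp (t * η ω)) P := fun t =>
    (hint.const_mul (rexp (c ^ 2 * t ^ 2))).mono' (by fun_prop)
      (ae_of_all _ fun ω => by
        rw [Real.norm_eq_abs, abs_of_pos (exp_pos _)]; exact hbound t ω)
  refine ⟨hexp, fun t => ?_⟩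
  change ∫ ω, rexp (t * η ω) ∂P ≤ rexp (18 * c ^ 2 * t ^ 2 / 2)
  -- The target exponent is `9 c² t²`. For small `t` centering gives `2p = 8 c² t²`; for large `t`
  -- the crude bound `c² t² + 2` suffices because `2 < 8 c² t²`.
  rcases le_or_gt (4 * c ^ 2 * t ^ 2) 1 with ht | ht
  · have hp : ∀ ω, rexp (t * η ω) ≤ t * η ω + rexp (η ω ^ 2 / (4 * c ^ 2)) ^ (4 * c ^ 2 * t ^ 2) := by
      intro ω
      refine (Real.exp_le_add_exp_sq _).trans (le_of_eq ?_)
      rw [← Real.exp_mul]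
      congr 2
      field_simp
    set p := 4 * c ^ 2 * t ^ 2 with hpdef
    have hp0 : 0 ≤ p := by positivity
    -- In place of Jensen for the concave power `p ≤ 1`: Bernoulli's inequality for `exp (-2) W`,
    -- normalized so that its mean is at most `1`.
    have hber : ∀ ω, rexp (η ω ^ 2 / (4 * c ^ 2)) ^ p ≤
        rexp (2 * p) * (1 - p + p * rexp (-2) * rexp (η ω ^ 2 / (4 * c ^ 2))) := by
      intro ω
      set W := rexp (η ω ^ 2 / (4 * c ^ 2))
      have hW : 0 < W := exp_pos _
      have hb := rpow_one_add_le_one_add_mul_self (s := rexp (-2) * W - 1)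
        (by nlinarith [exp_pos (-2 : ℝ)]) hp0 ht
      rw [add_sub_cancel, Real.mul_rpow (exp_pos _).le hW.le, ← Real.exp_mul] at hb
      calc W ^ p = rexp (2 * p) * (rexp (-2 * p) * W ^ p) := by
            rw [← mul_assoc, ← Real.exp_add]; simp
        _ ≤ rexp (2 * p) * (1 + p * (rexp (-2) * W - 1)) := by gcongr
        _ = _ := by ring
    have hη1 : Integrable η P := by
      refine ((hexp 1).add (hexp (-1))).mono' (by fun_prop) (ae_of_all _ fun ω => ?_)
      have h1 := add_one_le_exp (η ω)
      have h2 := add_one_le_exp (-η ω)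
      have h3 := exp_pos (η ω)
      have h4 := exp_pos (-η ω)
      simp only [Pi.add_apply, one_mul, neg_mul]
      exact abs_le.2 ⟨by linarith, by linarith⟩
    have hbern : Integrable (fun ω => 1 - p + p * rexp (-2) * rexp (η ω ^ 2 / (4 * c ^ 2))) P :=
      (integrable_const _).add (hint.const_mul _)
    calc ∫ ω, rexp (t * η ω) ∂P
        ≤ ∫ ω, (t * η ω + rexp (2 * p) *
            (1 - p + p * rexp (-2) * rexp (η ω ^ 2 / (4 * c ^ 2)))) ∂P := by
          refine integral_mono (hexp t) ?_ fun ω => (hp ω).trans (by gcongr; exact hber ω)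
          exact (hη1.const_mul t).add (hbern.const_mul _)
      _ = rexp (2 * p) * (1 - p + p * rexp (-2) * ∫ ω, rexp (η ω ^ 2 / (4 * c ^ 2)) ∂P) := by
          rw [integral_add (hη1.const_mul t) (hbern.const_mul _),
            integral_const_mul, h0, integral_const_mul,
            integral_add (integrable_const _) (hint.const_mul _), integral_const_mul]
          simp
      _ ≤ rexp (2 * p) * (1 - p + p * rexp (-2) * rexp 2) := by gcongr
      _ = rexp (2 * p) := by rw [mul_assoc, ← Real.exp_add]; simp
      _ ≤ _ := exp_le_exp.2 (by rw [hpdef]; nlinarith [mul_nonneg (sq_nonneg c) (sq_nonneg t)])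
  · calc ∫ ω, rexp (t * η ω) ∂P
        ≤ ∫ ω, rexp (c ^ 2 * t ^ 2) * rexp (η ω ^ 2 / (4 * c ^ 2)) ∂P :=
          integral_mono (hexp t) (hint.const_mul _) (hbound t)
      _ ≤ rexp (c ^ 2 * t ^ 2) * rexp 2 := by
          rw [integral_const_mul]; gcongr
      _ ≤ _ := by
          rw [← Real.exp_add]
          exact exp_le_exp.2 (by linarith)

end SubGaussian

/-! ### Independent families of standardized sub-Gaussian variables -/

section Families

open Real
open scoped NNReal ENNReal

variable {Ω : Type*} [MeasurableSpace Ω] {P : Measure Ω}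

/-- Measurable functions of disjoint groups of independent variables are independent. -/
theorem ProbabilityTheory.iIndepFun.of_disjoint_groups {ι κ : Type*} {X : ι → Ω → ℝ}
    (hX : iIndepFun X P) (hm : ∀ i, Measurable (X i)) (S : κ → Finset ι)
    (hS : Pairwise (Function.onFun Disjoint S)) {Y : κ → Ω → ℝ}
    (hY : ∀ b, Measurable[⨆ i ∈ (S b : Set ι), MeasurableSpace.comap (X i) inferInstance] (Y b)) :
    iIndepFun Y P := by
  classical
  have := hX.isProbabilityMeasure
  rw [iIndepFun_iff]
  intro s f hf
  have hf' : ∀ b ∈ s, MeasurableSet[⨆ i ∈ (S b : Set ι), MeasurableSpace.comap (X i) inferInstance]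
      (f b) := fun b hb => (hY b).comap_le _ (hf b hb)
  clear hf
  induction s using Finset.induction_on with
  | empty => simp
  | insert b s hb ih =>
    have ih := ih fun c hc => hf' c (Finset.mem_insert_of_mem hc)
    rw [Finset.prod_insert hb, ← ih, Finset.set_biInter_insert]
    have hind : Indep (⨆ i ∈ (S b : Set ι), MeasurableSpace.comap (X i) inferInstance)
        (⨆ i ∈ ((s.biUnion S : Finset ι) : Set ι), MeasurableSpace.comap (X i) inferInstance) P := by
      refine indep_iSup_of_disjoint (fun i => (hm i).comap_le) hX.iIndep ?_
      rw [Finset.disjoint_coe, Finset.disjoint_biUnion_right]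
      exact fun c hc => hS fun h => hb (h ▸ hc)
    refine (Indep_iff _ _ _).1 hind _ _ (hf' b (Finset.mem_insert_self _ _)) ?_
    refine s.measurableSet_biInter fun c hc => ?_
    refine (biSup_mono (f := fun i => MeasurableSpace.comap (X i) inferInstance) ?_) _
      (hf' c (Finset.mem_insert_of_mem hc))
    intro i hi
    exact Finset.mem_coe.2 (Finset.mem_biUnion.2 ⟨c, hc, hi⟩)

/-- Independent centered random variables of unit variance with a common sub-Gaussian parameter. -/
structure IsStdSubgaussianFamily {ι : Type*} (P : Measure Ω) (X : ι → Ω → ℝ) (τ : ℝ≥0) : Prop where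
  measurable : ∀ i, Measurable (X i)
  indep : iIndepFun X P
  mgf : ∀ i, HasSubgaussianMGF (X i) τ P
  mean : ∀ i, ∫ ω, X i ω ∂P = 0
  variance : ∀ i, variance (X i) P = 1

namespace IsStdSubgaussianFamily

theorem memLp_two {ι : Type*} {X : ι → Ω → ℝ} {τ : ℝ≥0} (h : IsStdSubgaussianFamily P X τ) (i : ι) :
    MemLp (X i) 2 P := (h.mgf i).memLp 2

theorem integral_sq {ι : Type*} {X : ι → Ω → ℝ} {τ : ℝ≥0} (h : IsStdSubgaussianFamily P X τ)
    (i : ι) : ∫ ω, X i ω ^ 2 ∂P = 1 := by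
  rw [← h.variance i, variance_of_integral_eq_zero (h.measurable i).aemeasurable (h.mean i)]

theorem precomp {ι κ : Type*} {X : ι → Ω → ℝ} {τ : ℝ≥0} (h : IsStdSubgaussianFamily P X τ)
    {g : κ → ι} (hg : g.Injective) : IsStdSubgaussianFamily P (fun b => X (g b)) τ :=
  ⟨fun _ => h.measurable _, h.indep.precomp hg, fun _ => h.mgf _, fun _ => h.mean _,
    fun _ => h.variance _⟩

/-- Normalized linear combinations over disjoint groups form again such a family. -/
theorem blockSum {ι κ : Type*} {X : ι → Ω → ℝ} {τ : ℝ≥0} (h : IsStdSubgaussianFamily P X τ)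
    (S : κ → Finset ι) (hS : Pairwise (Function.onFun Disjoint S)) (w : κ → ι → ℝ)
    (hw : ∀ b, ∑ p ∈ S b, w b p ^ 2 = 1) :
    IsStdSubgaussianFamily P (fun b ω => ∑ p ∈ S b, w b p * X p ω) τ where
  measurable b := Finset.measurable_fun_sum _ fun p _ => (h.measurable p).const_mul _
  indep := by
    refine h.indep.of_disjoint_groups h.measurable S hS fun b => ?_
    refine Finset.measurable_fun_sum _ fun p hp => Measurable.const_mul ?_ _
    exact (comap_measurable (X p)).mono
      (le_iSup₂_of_le (f := fun i (_ : i ∈ (S b : Set ι)) =>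
        MeasurableSpace.comap (X i) inferInstance) p hp le_rfl) le_rfl
  mgf b := by
    have hind : iIndepFun (fun p ω => w b p * X p ω) P :=
      h.indep.comp (fun p x => w b p * x) fun p => by fun_prop
    have := HasSubgaussianMGF.sum_of_iIndepFun hind (s := S b)
      (c := fun p => Real.toNNReal (w b p ^ 2) * τ) fun p _ => by
        convert! (h.mgf p).const_mul (w b p) using 2
        refine congrArg _ ?_
        exact Real.toNNReal_of_nonneg (sq_nonneg _)
    convert! this using 1
    refine NNReal.eq ?_
    push_cast
    simp only [Real.coe_toNNReal _ (sq_nonneg _), ← Finset.sum_mul, hw, one_mul]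
  mean b := by
    rw [integral_finsetSum _ fun p _ => ((h.mgf p).integrable).const_mul _]
    refine Finset.sum_eq_zero fun p _ => ?_
    rw [integral_const_mul, h.mean, mul_zero]
  variance b := by
    have e : (fun ω => ∑ p ∈ S b, w b p * X p ω) = ∑ p ∈ S b, fun ω => w b p * X p ω := by
      ext ω; simp
    rw [e, IndepFun.variance_sum]
    · simp_rw [variance_const_mul, h.variance, mul_one]
      exact hw b
    · exact fun p _ => (h.memLp_two p).const_mul _
    · intro p _ q _ hpq
      exact (h.indep.indepFun hpq).comp (φ := fun x => w b p * x) (ψ := fun x => w b q * x)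
        (by fun_prop) (by fun_prop)

end IsStdSubgaussianFamily

theorem chernoff_of_iIndepFun {ι : Type*} [Fintype ι] {Z : ι → Ω → ℝ} (h : iIndepFun Z P)
    (hm : ∀ i, Measurable (Z i)) (hint : ∀ i, Integrable (fun ω => rexp (Z i ω)) P) {K : ℝ}
    (hK : ∀ i, ∫ ω, rexp (Z i ω) ∂P ≤ rexp K) (v : ℝ) :
    P.real {ω | v ≤ ∑ i, Z i ω} ≤ rexp (Fintype.card ι * K - v) := by
  have := h.isProbabilityMeasure
  have hint' : ∀ i ∈ Finset.univ, Integrable (fun ω => rexp (1 * Z i ω)) P := fun i _ => by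
    simpa using hint i
  have h1 := measure_ge_le_exp_mul_mgf (μ := P) (X := ∑ i, Z i) (t := 1) v zero_le_one
    (h.integrable_exp_mul_sum hm hint')
  rw [h.mgf_sum hm] at h1
  have h2 : ∏ i, mgf (Z i) P 1 ≤ ∏ _i : ι, rexp K :=
    Finset.prod_le_prod (fun i _ => mgf_nonneg) fun i _ => by simpa [mgf] using hK i
  simp only [Finset.prod_const, Finset.card_univ, ← Real.exp_nat_mul] at h2
  have h3 : {ω | v ≤ (∑ i, Z i) ω} = {ω | v ≤ ∑ i, Z i ω} := by
    ext ω; simp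
  rw [h3] at h1
  calc _ ≤ _ := h1
    _ ≤ rexp (-1 * v) * rexp (Fintype.card ι * K) := by gcongr
    _ = _ := by rw [← Real.exp_add]; congr 1; ring

/-- Exponential moments of a centered square. -/
theorem integral_exp_mul_sq_sub_one_le [IsProbabilityMeasure P] {Y : Ω → ℝ} {τ : ℝ≥0} (hτ : 0 < τ)
    (hm : Measurable Y) (h : HasSubgaussianMGF Y τ P) (h2 : ∫ ω, Y ω ^ 2 ∂P = 1)
    {σ : ℝ} (hσ : σ = 1 / (4 * τ)) {s : ℝ} (hs : |s| ≤ σ / 2) :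
    Integrable (fun ω => rexp (s * (Y ω ^ 2 - 1))) P ∧
      ∫ ω, rexp (s * (Y ω ^ 2 - 1)) ∂P ≤ rexp (16 * rexp σ / σ ^ 2 * s ^ 2) := by
  have hσ0 : 0 < σ := by rw [hσ]; have : (0 : ℝ) < τ := hτ; positivity
  obtain ⟨hint, hle⟩ := integral_exp_sq_le_of_hasSubgaussianMGF hτ h
  have e : ∀ ω, Y ω ^ 2 / (4 * τ) = σ * Y ω ^ 2 := fun ω => by rw [hσ]; ring
  simp only [e] at hint hle
  have hsq : Integrable (fun ω => Y ω ^ 2) P := (h.memLp 2).integrable_sq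
  -- With `|s| ≤ σ / 2`, half of the available exponent pays for `exp |s z|` and the other half for
  -- `z²`; together they use `exp (σ |z|) ≤ exp σ * exp (σ Y²)`.
  have hpt : ∀ ω, rexp (s * (Y ω ^ 2 - 1)) ≤
      1 + s * (Y ω ^ 2 - 1) + 8 * rexp σ / σ ^ 2 * s ^ 2 * rexp (σ * Y ω ^ 2) := by
    intro ω
    set z := Y ω ^ 2 - 1 with hz
    have hzabs : |z| ≤ Y ω ^ 2 + 1 := abs_le.2 ⟨by nlinarith [sq_nonneg (Y ω)], by linarith⟩
    have h1 := Real.exp_le_one_add_add_sq_mul_exp_abs (s * z)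
    have h3 : rexp |s * z| ≤ rexp (σ / 2 * |z|) := by
      rw [abs_mul]; gcongr
    have h4 : z ^ 2 ≤ 8 / σ ^ 2 * rexp (σ / 2 * |z|) := by
      have := Real.quadratic_le_exp_of_nonneg (x := σ / 2 * |z|) (by positivity)
      rw [div_mul_eq_mul_div, le_div_iff₀ (by positivity)]
      have h5 : (σ / 2 * |z|) ^ 2 = σ ^ 2 * z ^ 2 / 4 := by rw [mul_pow, sq_abs]; ring
      have h6 : 0 ≤ σ / 2 * |z| := by positivity
      linarith
    have h5 : rexp (σ / 2 * |z|) * rexp (σ / 2 * |z|) ≤ rexp σ * rexp (σ * Y ω ^ 2) := by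
      rw [← Real.exp_add, ← Real.exp_add]
      refine exp_le_exp.2 ?_
      nlinarith
    calc _ ≤ _ := h1
      _ ≤ 1 + s * z + s ^ 2 * (8 / σ ^ 2 * (rexp (σ / 2 * |z|) * rexp (σ / 2 * |z|))) := by
        rw [mul_pow, mul_assoc, ← mul_assoc (8 / σ ^ 2)]; gcongr
      _ ≤ 1 + s * z + s ^ 2 * (8 / σ ^ 2 * (rexp σ * rexp (σ * Y ω ^ 2))) := by gcongr
      _ = _ := by ring
  have hint2 : Integrable (fun ω => s * (Y ω ^ 2 - 1)) P := (hsq.sub (integrable_const _)).const_mul s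
  have hint1 : Integrable (fun ω => 1 + s * (Y ω ^ 2 - 1)) P := (integrable_const _).add hint2
  have hint3 := hint.const_mul (8 * rexp σ / σ ^ 2 * s ^ 2)
  have hI : Integrable (fun ω => rexp (s * (Y ω ^ 2 - 1))) P :=
    (hint1.add hint3).mono' (by fun_prop) (ae_of_all _ fun ω => by
      rw [Real.norm_eq_abs, abs_of_pos (exp_pos _)]; exact hpt ω)
  refine ⟨hI, ?_⟩
  calc _ ≤ ∫ ω, (1 + s * (Y ω ^ 2 - 1) + 8 * rexp σ / σ ^ 2 * s ^ 2 * rexp (σ * Y ω ^ 2)) ∂P :=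
        integral_mono hI (hint1.add hint3) hpt
    _ = 1 + 8 * rexp σ / σ ^ 2 * s ^ 2 * ∫ ω, rexp (σ * Y ω ^ 2) ∂P := by
        rw [integral_add hint1 hint3, integral_add (integrable_const _) hint2, integral_const_mul,
          integral_sub hsq (integrable_const _), h2, integral_const_mul]
        simp
    _ ≤ 1 + 8 * rexp σ / σ ^ 2 * s ^ 2 * 2 := by gcongr
    _ = 16 * rexp σ / σ ^ 2 * s ^ 2 + 1 := by ring
    _ ≤ _ := add_one_le_exp _

/-- Concentration of the squared norm of an independent sub-Gaussian vector. -/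
theorem exists_concentration_rate.{u} {τ : ℝ≥0} (hτ : 0 < τ) {t : ℝ} (ht : 0 < t) :
    ∃ c : ℝ, 0 < c ∧ ∀ (Ω : Type u) [MeasurableSpace Ω] (P : Measure Ω) [IsProbabilityMeasure P]
      (n : ℕ) (Y : Fin n → Ω → ℝ), IsStdSubgaussianFamily P Y τ →
      P.real {ω | t * n ≤ |∑ i, Y i ω ^ 2 - n|} ≤ 2 * rexp (-c * n) := by
  have hτ' : (0 : ℝ) < τ := hτ
  obtain ⟨σ, hσ⟩ : ∃ σ : ℝ, σ = 1 / (4 * τ) := ⟨_, rfl⟩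
  have hσ0 : 0 < σ := by rw [hσ]; positivity
  set K : ℝ := 16 * rexp σ / σ ^ 2 with hK
  have hK0 : 0 < K := by positivity
  -- The first bound keeps `s` in the range of the moment estimate; the second makes `K s² ≤ s t /
  -- 2`, so half of the Chernoff gain `s t` per coordinate survives.
  set s : ℝ := min (σ / 2) (t / (2 * K)) with hs
  have hs0 : 0 < s := lt_min (by positivity) (by positivity)
  have hs1 : s ≤ σ / 2 := min_le_left _ _
  have hs2 : K * s ≤ t / 2 := by
    have := (min_le_right (σ / 2) (t / (2 * K)))
    rw [← hs, le_div_iff₀ (by positivity)] at this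
    linarith
  refine ⟨s * t / 2, by positivity, ?_⟩
  intro Ω _ P _ n Y hY
  have tail : ∀ s' : ℝ, |s'| = s →
      P.real {ω | s * (t * n) ≤ ∑ i, s' * (Y i ω ^ 2 - 1)} ≤ rexp (-(s * t / 2) * n) := by
    intro s' hs'
    have hmom : ∀ i, _ := fun i => integral_exp_mul_sq_sub_one_le (P := P) hτ (hY.measurable i)
      (hY.mgf i) (hY.integral_sq i) hσ (hs'.le.trans hs1)
    have hind : iIndepFun (fun i ω => s' * (Y i ω ^ 2 - 1)) P :=
      hY.indep.comp (fun _ x => s' * (x ^ 2 - 1)) fun _ => by fun_prop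
    have := chernoff_of_iIndepFun hind
      (fun i => ((hY.measurable i).pow_const 2 |>.sub_const 1).const_mul s')
      (fun i => (hmom i).1) (fun i => (hmom i).2) (s * (t * n))
    refine this.trans (exp_le_exp.2 ?_)
    rw [← sq_abs s', hs', Fintype.card_fin]
    have hn : (0 : ℝ) ≤ n := Nat.cast_nonneg n
    nlinarith [mul_nonneg (mul_nonneg hs0.le hn) (sub_nonneg.2 hs2)]
  have hsub : {ω | t * n ≤ |∑ i, Y i ω ^ 2 - n|} ⊆
      {ω | s * (t * n) ≤ ∑ i, s * (Y i ω ^ 2 - 1)} ∪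
        {ω | s * (t * n) ≤ ∑ i, -s * (Y i ω ^ 2 - 1)} := by
    intro ω hω
    simp only [Set.mem_ofPred_eq, Set.mem_union, ← Finset.mul_sum, Finset.sum_sub_distrib,
      Finset.sum_const, Finset.card_univ, Fintype.card_fin, nsmul_eq_mul, mul_one] at hω ⊢
    rcases le_abs.1 hω with h | h
    · left; gcongr
    · right
      rw [neg_mul, ← mul_neg]; gcongr
  calc _ ≤ _ := measureReal_mono hsub
    _ ≤ _ := measureReal_union_le _ _
    _ ≤ _ := by
      have h1 := tail s (abs_of_pos hs0)
      have h2 := tail (-s) (by rw [abs_neg, abs_of_pos hs0])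
      linarith

end Families

/-! ### The restricted isometry property of sub-Gaussian matrices -/

section RIP

open Real
open scoped NNReal ENNReal

theorem l2Norm_sq {ι : Type*} [Fintype ι] (v : ι → ℝ) : l2Norm v ^ 2 = ∑ i, v i ^ 2 := by
  simp [l2Norm, EuclideanSpace.norm_sq_eq]

theorem l2Norm_nonneg {ι : Type*} [Fintype ι] (v : ι → ℝ) : 0 ≤ l2Norm v := norm_nonneg _

/-- Near isometry on the unit sphere controls the quadratic form. -/
theorem abs_sq_norm_sub_le_of_unit {E F : Type*} [NormedAddCommGroup E] [NormedSpace ℝ E]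
    [NormedAddCommGroup F] [NormedSpace ℝ F] (B : E →L[ℝ] F) {η : ℝ}
    (h : ∀ x : E, ‖x‖ = 1 → |‖B x‖ - 1| ≤ η) (x : E) :
    |‖B x‖ ^ 2 - ‖x‖ ^ 2| ≤ η * (2 + η) * ‖x‖ ^ 2 := by
  rcases eq_or_ne x 0 with rfl | hx
  · simp
  · have hx' : 0 < ‖x‖ := norm_pos_iff.2 hx
    have hu := h (‖x‖⁻¹ • x) (by rw [norm_smul, norm_inv, norm_norm, inv_mul_cancel₀ hx'.ne'])
    set b := ‖B (‖x‖⁻¹ • x)‖ with hb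
    have hBx : ‖B x‖ = ‖x‖ * b := by
      rw [hb, map_smul, norm_smul, norm_inv, norm_norm, mul_inv_cancel_left₀ hx'.ne']
    have hb2 : |b ^ 2 - 1| ≤ η * (2 + η) := by
      have : b ^ 2 - 1 = (b - 1) * (2 + (b - 1)) := by ring
      rw [this, abs_mul]
      have h0 : 0 ≤ η := (abs_nonneg _).trans hu
      have h1 : |2 + (b - 1)| ≤ 2 + η := (abs_add_le _ _).trans (by rw [abs_two]; linarith)
      gcongr
    have : ‖B x‖ ^ 2 - ‖x‖ ^ 2 = (b ^ 2 - 1) * ‖x‖ ^ 2 := by rw [hBx]; ring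
    rw [this, abs_mul, abs_of_nonneg (sq_nonneg ‖x‖)]
    gcongr

/-- This is `N.choose s ≤ N ^ s / s! ≤ (eN / s) ^ s`, from `s ^ s / s! ≤ e ^ s`. -/
theorem choose_le_exp_mul_log {N s : ℕ} (hs : 1 ≤ s) (hsN : s ≤ N) :
    (N.choose s : ℝ) ≤ rexp (s * log (rexp 1 * N / s)) := by
  have hs' : (0 : ℝ) < s := by exact_mod_cast hs
  have hN' : (0 : ℝ) < N := by exact_mod_cast hs.trans hsN
  rw [Real.exp_nat_mul, Real.exp_log (by positivity)]
  have h1 : (N.choose s : ℝ) ≤ (N : ℝ) ^ s / s.factorial := Nat.choose_le_pow_div s N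
  have h2 := Real.pow_div_factorial_le_exp (s : ℝ) hs'.le s
  have h3 : (0 : ℝ) < s.factorial := by exact_mod_cast s.factorial_pos
  rw [div_le_iff₀ h3] at h2
  refine h1.trans ?_
  rw [div_pow, mul_pow, ← Real.exp_nat_mul, mul_one, div_le_div_iff₀ h3 (by positivity)]
  calc (N : ℝ) ^ s * s ^ s ≤ (N : ℝ) ^ s * (rexp s * s.factorial) := by gcongr
    _ = _ := by ring

theorem one_le_log_exp_mul_div {N s : ℕ} (hs : 1 ≤ s) (hsN : s ≤ N) :
    1 ≤ log (rexp 1 * N / s) := by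
  have hs' : (0 : ℝ) < s := by exact_mod_cast hs
  have hN' : (0 : ℝ) < N := by exact_mod_cast hs.trans hsN
  rw [Real.le_log_iff_exp_le (by positivity), le_div_iff₀ hs']
  gcongr

/-- Entries of a random matrix applied to a fixed unit vector. -/
theorem IsStdSubgaussianFamily.mulVec {Ω : Type*} [MeasurableSpace Ω] {P : Measure Ω}
    {n : ℕ} {ι : Type*} [Fintype ι] {A : Ω → Matrix (Fin n) ι ℝ} {τ : ℝ≥0}
    (hA : IsStdSubgaussianFamily P (fun (p : Fin n × ι) ω => A ω p.1 p.2) τ) (x : ι → ℝ)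
    (hx : ∑ j, x j ^ 2 = 1) : IsStdSubgaussianFamily P (fun i ω => (A ω *ᵥ x) i) τ := by
  classical
  have := hA.blockSum (fun i : Fin n => {i} ×ˢ (Finset.univ : Finset ι)) (fun i j hij => by
      simp only [Function.onFun, Finset.disjoint_left, Finset.mem_product, Finset.mem_singleton]
      rintro p ⟨h1, -⟩ ⟨h2, -⟩
      exact hij (h1.symm.trans h2)) (fun _ p => x p.2) (fun i => by
      simpa [Finset.sum_product] using hx)
  simpa [Finset.sum_product, Matrix.mulVec, dotProduct, mul_comm] using this

/-- Uniform concentration over a coordinate space. -/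
theorem exists_isometry_rate.{u} {τ : ℝ≥0} (hτ : 0 < τ) {γ : ℝ} (hγ : 0 < γ) (hγ1 : γ ≤ 1) :
    ∃ c : ℝ, 0 < c ∧ ∀ (Ω : Type u) [MeasurableSpace Ω] (P : Measure Ω) [IsProbabilityMeasure P]
      (n : ℕ) (_ : 0 < n) (ι : Type) [Fintype ι] (A : Ω → Matrix (Fin n) ι ℝ),
      IsStdSubgaussianFamily P (fun (p : Fin n × ι) ω => A ω p.1 p.2) τ →
      P.real {ω | ∃ x : ι → ℝ, γ * l2Norm x ^ 2 < |l2Norm (A ω *ᵥ x) ^ 2 / n - l2Norm x ^ 2|} ≤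
        (1 + 40 / γ) ^ Fintype.card ι * (2 * rexp (-c * n)) := by
  classical
  obtain ⟨c, hc, H⟩ := exists_concentration_rate.{u} hτ (t := γ / 20) (by positivity)
  refine ⟨c, hc, ?_⟩
  intro Ω _ P _ n hn ι _ A hA
  have hn' : (0 : ℝ) < n := by exact_mod_cast hn
  -- Tolerance and mesh `γ / 20` give distortion `η = γ / 20 + 4 (γ / 20) = γ / 4` on the sphere,
  -- and `η (2 + η) ≤ γ` since `γ ≤ 1`.
  obtain ⟨s, hs1, hcard, hnet⟩ := exists_net_unitSphere (E := EuclideanSpace ℝ ι)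
    (ε := γ / 20) (by positivity)
  have hsub : {ω | ∃ x : ι → ℝ, γ * l2Norm x ^ 2 < |l2Norm (A ω *ᵥ x) ^ 2 / n - l2Norm x ^ 2|} ⊆
      ⋃ y ∈ s, {ω | γ / 20 * n ≤ |∑ i, (A ω *ᵥ y.ofLp) i ^ 2 - n|} := by
    intro ω hω
    by_contra hcon
    simp only [Set.mem_iUnion, not_exists, Set.mem_ofPred_eq, not_le] at hcon
    obtain ⟨x, hx⟩ := hω
    let B : EuclideanSpace ℝ ι →L[ℝ] EuclideanSpace ℝ (Fin n) :=
      (√n)⁻¹ • LinearMap.toContinuousLinearMap (Matrix.toLpLin 2 2 (A ω))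
    have hB : ∀ y : EuclideanSpace ℝ ι, ‖B y‖ ^ 2 = l2Norm (A ω *ᵥ y.ofLp) ^ 2 / n := by
      intro y
      simp only [B, smul_apply, norm_smul, mul_pow, norm_inv, Real.norm_eq_abs,
        inv_pow, sq_abs, Real.sq_sqrt hn'.le, LinearMap.coe_toContinuousLinearMap',
        Matrix.toLpLin_apply]
      rw [div_eq_inv_mul]
      rfl
    have hBs : ∀ y ∈ s, |‖B y‖ - 1| ≤ γ / 20 := by
      intro y hy
      have h1 := hcon y hy
      rw [← l2Norm_sq] at h1
      have h2 : |‖B y‖ ^ 2 - 1| ≤ γ / 20 := by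
        have e : ‖B y‖ ^ 2 - 1 = (l2Norm (A ω *ᵥ y.ofLp) ^ 2 - n) / n := by
          rw [hB]; field_simp
        rw [e, abs_div, abs_of_pos hn', div_le_iff₀ hn']
        exact h1.le
      refine le_trans ?_ h2
      rw [show ‖B y‖ ^ 2 - 1 = (‖B y‖ - 1) * (‖B y‖ + 1) by ring, abs_mul]
      have h3 : 1 ≤ |‖B y‖ + 1| := by
        rw [abs_of_nonneg (by positivity)]
        linarith [norm_nonneg (B y)]
      exact le_mul_of_one_le_right (abs_nonneg _) h3
    have hunit : ∀ y : EuclideanSpace ℝ ι, ‖y‖ = 1 → |‖B y‖ - 1| ≤ γ / 20 + 4 * (γ / 20) :=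
      fun y hy => near_isometry_of_net B s (by linarith) (by linarith) hnet hBs hy
    have hfin := abs_sq_norm_sub_le_of_unit B hunit (WithLp.toLp 2 x)
    rw [hB] at hfin
    have hη : (γ / 20 + 4 * (γ / 20)) * (2 + (γ / 20 + 4 * (γ / 20))) ≤ γ := by nlinarith
    exact absurd (hfin.trans (mul_le_mul_of_nonneg_right hη (sq_nonneg _))) (not_le.2 hx)
  have hpt : ∀ y ∈ s, P.real {ω | γ / 20 * n ≤ |∑ i, (A ω *ᵥ y.ofLp) i ^ 2 - n|} ≤
      2 * rexp (-c * n) := by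
    intro y hy
    refine H Ω P n _ (hA.mulVec y.ofLp ?_)
    rw [← l2Norm_sq]
    change ‖y‖ ^ 2 = 1
    rw [hs1 y hy, one_pow]
  calc _ ≤ _ := measureReal_mono hsub (measure_ne_top _ _)
    _ ≤ ∑ y ∈ s, P.real {ω | γ / 20 * n ≤ |∑ i, (A ω *ᵥ y.ofLp) i ^ 2 - n|} :=
      measureReal_biUnion_finset_le _ _
    _ ≤ s.card * (2 * rexp (-c * n)) := by
      rw [← nsmul_eq_mul]; exact Finset.sum_le_card_nsmul _ _ _ hpt
    _ ≤ _ := by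
      gcongr
      refine hcard.trans (le_of_eq ?_)
      rw [finrank_euclideanSpace]
      congr 2
      field_simp
      norm_num

theorem l2Norm_restrict {N : ℕ} {x : Fin N → ℝ} {T : Finset (Fin N)} (h : supp x ⊆ T) :
    l2Norm (fun j : T => x j) = l2Norm x := by
  refine (sq_eq_sq₀ (l2Norm_nonneg _) (l2Norm_nonneg _)).1 ?_
  rw [l2Norm_sq, l2Norm_sq, Finset.sum_coe_sort T fun j => x j ^ 2]
  refine Finset.sum_subset (Finset.subset_univ _) fun j _ hj => ?_
  have : x j = 0 := by
    by_contra hx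
    exact hj (h (by simp [supp, hx]))
  simp [this]

theorem columns_mulVec_restrict {m N : ℕ} (A : Matrix (Fin m) (Fin N) ℝ) {x : Fin N → ℝ}
    {T : Finset (Fin N)} (h : supp x ⊆ T) : columns A T *ᵥ (fun j : T => x j) = A *ᵥ x := by
  ext i
  simp only [Matrix.mulVec, dotProduct, columns, Matrix.submatrix_apply, id_eq]
  rw [Finset.sum_coe_sort T fun j => A i j * x j]
  refine Finset.sum_subset (Finset.subset_univ _) fun j _ hj => ?_
  have : x j = 0 := by
    by_contra hx
    exact hj (h (by simp [supp, hx]))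
  simp [this]

theorem exists_superset_of_isSparse {N s : ℕ} {x : Fin N → ℝ} (hx : IsSparse s x) (hsN : s ≤ N) :
    ∃ T ∈ Finset.powersetCard s (Finset.univ : Finset (Fin N)), supp x ⊆ T := by
  obtain ⟨T, h1, -, h3⟩ := Finset.exists_subsuperset_card_eq (Finset.subset_univ (supp x)) hx
    (by simpa using hsN)
  exact ⟨T, Finset.mem_powersetCard.2 ⟨Finset.subset_univ _, h3⟩, h1⟩

/-- Matrices with independent standardized sub-Gaussian entries satisfy the restricted isometry
property with overwhelming probability. -/
theorem exists_rip_rate.{u} {τ : ℝ≥0} (hτ : 0 < τ) {γ : ℝ} (hγ : 0 < γ) (hγ1 : γ ≤ 1) :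
    ∃ c κ : ℝ, 0 < c ∧ 0 < κ ∧ ∀ (Ω : Type u) [MeasurableSpace Ω] (P : Measure Ω)
      [IsProbabilityMeasure P] (n N s : ℕ) (_ : 0 < n) (_ : 1 ≤ s) (_ : s ≤ N)
      (A : Ω → Matrix (Fin n) (Fin N) ℝ),
      IsStdSubgaussianFamily P (fun (p : Fin n × Fin N) ω => A ω p.1 p.2) τ →
      P.real {ω | ∃ x : Fin N → ℝ, IsSparse s x ∧
          γ * l2Norm x ^ 2 < |l2Norm (A ω *ᵥ x) ^ 2 / n - l2Norm x ^ 2|} ≤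
        2 * rexp (κ * (s * log (rexp 1 * N / s)) - c * n) := by
  obtain ⟨c, hc, H⟩ := exists_isometry_rate.{u} hτ hγ hγ1
  have hb : 1 < 1 + 40 / γ := by
    have : 0 < 40 / γ := by positivity
    linarith
  have hlog : 0 < log (1 + 40 / γ) := Real.log_pos hb
  -- The `1` pays for the choice of support and the logarithm for the net; the latter is multiplied
  -- by `log (eN / s) ≥ 1` to share one entropy term.
  refine ⟨c, 1 + log (1 + 40 / γ), hc, by positivity, ?_⟩
  intro Ω _ P _ n N s hn hs hsN A hA
  have hsub : {ω | ∃ x : Fin N → ℝ, IsSparse s x ∧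
          γ * l2Norm x ^ 2 < |l2Norm (A ω *ᵥ x) ^ 2 / n - l2Norm x ^ 2|} ⊆
      ⋃ T ∈ Finset.powersetCard s (Finset.univ : Finset (Fin N)), {ω | ∃ x : T → ℝ,
        γ * l2Norm x ^ 2 < |l2Norm (columns (A ω) T *ᵥ x) ^ 2 / n - l2Norm x ^ 2|} := by
    rintro ω ⟨x, hx, hlt⟩
    obtain ⟨T, hT, hxT⟩ := exists_superset_of_isSparse hx hsN
    refine Set.mem_biUnion hT ⟨fun j => x j, ?_⟩
    rwa [columns_mulVec_restrict _ hxT, l2Norm_restrict hxT]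
  have hT : ∀ T ∈ Finset.powersetCard s (Finset.univ : Finset (Fin N)), P.real {ω | ∃ x : T → ℝ,
        γ * l2Norm x ^ 2 < |l2Norm (columns (A ω) T *ᵥ x) ^ 2 / n - l2Norm x ^ 2|} ≤
      (1 + 40 / γ) ^ s * (2 * rexp (-c * n)) := by
    intro T hT
    have := H Ω P n hn T (fun ω => columns (A ω) T)
      (hA.precomp (g := fun p : Fin n × T => (p.1, (p.2 : Fin N))) fun p q h => by
        simp only [Prod.mk.injEq] at h
        exact Prod.ext h.1 (Subtype.ext h.2))
    rwa [Fintype.card_coe, (Finset.mem_powersetCard.1 hT).2] at this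
  have hL := one_le_log_exp_mul_div hs hsN
  calc _ ≤ _ := measureReal_mono hsub (measure_ne_top _ _)
    _ ≤ _ := measureReal_biUnion_finset_le _ _
    _ ≤ (N.choose s : ℝ) * ((1 + 40 / γ) ^ s * (2 * rexp (-c * n))) := by
      refine (Finset.sum_le_card_nsmul _ _ _ hT).trans (le_of_eq ?_)
      rw [nsmul_eq_mul, Finset.card_powersetCard, Finset.card_univ, Fintype.card_fin]
    _ ≤ rexp (s * log (rexp 1 * N / s)) *
        (rexp (log (1 + 40 / γ) * (s * log (rexp 1 * N / s))) * (2 * rexp (-c * n))) := by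
      gcongr
      · exact choose_le_exp_mul_log hs hsN
      · have e : (1 + 40 / γ) ^ s = rexp (log (1 + 40 / γ) * s) := by
          rw [mul_comm, Real.exp_nat_mul, Real.exp_log (by linarith)]
        rw [e]
        refine exp_le_exp.2 ?_
        gcongr
        exact le_mul_of_one_le_right (Nat.cast_nonneg _) hL
    _ = _ := by
      rw [mul_left_comm _ 2, mul_left_comm _ 2, ← Real.exp_add, ← Real.exp_add]
      congr 2
      ring

end RIP

/-! ### Difference matrices and power series -/

section Difference

open PowerSeries

/-- The power series whose first coefficients are the entries of `u`. -/
noncomputable def vecSeries {m : ℕ} (u : Fin m → ℝ) : PowerSeries ℝ :=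
  PowerSeries.mk fun n => if h : n < m then u ⟨n, h⟩ else 0

theorem coeff_vecSeries {m : ℕ} (u : Fin m → ℝ) (i : Fin m) :
    coeff (i : ℕ) (vecSeries u) = u i := by
  simp [vecSeries]

/-- The difference matrix is multiplication by `1 - X` modulo `X ^ m`. Only the coefficients of `U`
below `m` are prescribed, since `(1 - X) * U` need not vanish beyond; this is what allows iteration.
-/
theorem diffMatrix_mulVec_eq_coeff {m : ℕ} {u : Fin m → ℝ} {U : PowerSeries ℝ}
    (h : ∀ i : Fin m, coeff (i : ℕ) U = u i) (i : Fin m) :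
    coeff (i : ℕ) ((1 - X) * U) = (diffMatrix m *ᵥ u) i := by
  obtain ⟨i, hi⟩ := i
  have hs : ∀ j : Fin m, diffMatrix m ⟨i, hi⟩ j * u j =
      (if j = ⟨i, hi⟩ then u j else 0) - (if i = j.1 + 1 then u j else 0) := by
    intro j
    simp only [diffMatrix, Matrix.of_apply, eq_comm (a := j)]
    by_cases h1 : (⟨i, hi⟩ : Fin m) = j
    · have : i ≠ j.1 + 1 := by rw [← h1]; simp
      simp [h1, this]
    · rw [if_neg h1, if_neg h1]
      split_ifs <;> simp
  simp only [Matrix.mulVec, dotProduct, hs, Finset.sum_sub_distrib, Finset.sum_ite_eq',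
    Finset.mem_univ, if_true]
  rw [sub_mul, one_mul, map_sub, h ⟨i, hi⟩]
  congr 1
  cases i with
  | zero => simp
  | succ i =>
    have hi' : i < m := by omega
    rw [coeff_succ_X_mul, h ⟨i, hi'⟩]
    have : ∀ j : Fin m, (i + 1 = j.1 + 1) ↔ (j = ⟨i, hi'⟩) := fun j => by
      rw [Fin.ext_iff]; constructor <;> intro h <;> simp_all
    simp only [this, Finset.sum_ite_eq', Finset.mem_univ, if_true]

theorem diffMatrix_pow_mulVec_eq_coeff {m : ℕ} (r : ℕ) {u : Fin m → ℝ} {U : PowerSeries ℝ}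
    (h : ∀ i : Fin m, coeff (i : ℕ) U = u i) (i : Fin m) :
    coeff (i : ℕ) ((1 - X) ^ r * U) = (diffMatrix m ^ r *ᵥ u) i := by
  induction r generalizing i with
  | zero => simp [h]
  | succ r ih =>
    rw [pow_succ', mul_assoc, pow_succ', ← Matrix.mulVec_mulVec]
    exact diffMatrix_mulVec_eq_coeff ih i

theorem coeff_one_sub_X_pow_mul (r : ℕ) (U : PowerSeries ℝ) (n : ℕ) :
    coeff n ((1 - X) ^ r * U) = coeff n U + ∑ j ∈ Finset.range r,
      if j + 1 ≤ n then (-1 : ℝ) ^ (j + 1) * (r.choose (j + 1) : ℝ) * coeff (n - (j + 1)) U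
      else 0 := by
  have e : ((1 : PowerSeries ℝ) - X) ^ r =
      ∑ j ∈ Finset.range (r + 1), C ((-1 : ℝ) ^ j * (r.choose j : ℝ)) * X ^ j := by
    rw [sub_eq_neg_add, add_pow]
    refine Finset.sum_congr rfl fun j _ => ?_
    rw [neg_pow, one_pow, mul_one, map_mul, map_pow, map_neg, map_one, map_natCast]
    ring
  rw [e, Finset.sum_mul, map_sum, Finset.sum_range_succ', add_comm]
  simp only [mul_assoc, coeff_C_mul, coeff_X_pow_mul']
  simp

theorem det_diffMatrix (m : ℕ) : (diffMatrix m).det = 1 := by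
  rw [Matrix.det_of_isLowerTriangular]
  · simp [diffMatrix]
  · intro i j hij
    have hij' : i < j := hij
    have h1 : i ≠ j := hij'.ne
    have h2 : i.1 ≠ j.1 + 1 := by have : i.1 < j.1 := hij'; omega
    simp [diffMatrix, h1, h2]

theorem isUnit_det_diffMatrix_pow (m r : ℕ) : IsUnit (diffMatrix m ^ r).det := by
  rw [Matrix.det_pow, det_diffMatrix, one_pow]
  exact isUnit_one

/-- Each difference at most doubles the sup norm. Applied to the state, this bounds the quantization
noise seen by the decoder. -/
theorem abs_diffMatrix_pow_mulVec_le {m : ℕ} (r : ℕ) {u : Fin m → ℝ} {b : ℝ}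
    (h : ∀ i, |u i| ≤ b) (i : Fin m) : |(diffMatrix m ^ r *ᵥ u) i| ≤ 2 ^ r * b := by
  induction r generalizing i with
  | zero => simpa using h i
  | succ r ih =>
    rw [pow_succ', ← Matrix.mulVec_mulVec,
      ← diffMatrix_mulVec_eq_coeff (coeff_vecSeries _), sub_mul, one_mul, map_sub,
      coeff_vecSeries]
    have h0 : 0 ≤ b := (abs_nonneg _).trans (h i)
    have h2 : |coeff (i : ℕ) (X * vecSeries (diffMatrix m ^ r *ᵥ u))| ≤ 2 ^ r * b := by
      obtain ⟨i, hi⟩ := i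
      cases i with
      | zero => simp; positivity
      | succ i =>
        have := ih ⟨i, by omega⟩
        rwa [← coeff_vecSeries (diffMatrix m ^ r *ᵥ u), ← coeff_succ_X_mul] at this
    refine (abs_sub _ _).trans ?_
    rw [pow_succ]
    linarith [ih i]

end Difference

/-! ### Block averages -/

section BlockAverage

open Polynomial

/-- Pairing with `f` read backwards from position `t` is a convolution, so it extracts the
coefficient of index `t` of a product of series. -/
theorem sum_fin_ite_sub {m t : ℕ} (ht : t < m) (f g : ℕ → ℝ) :
    ∑ i : Fin m, (if i.1 ≤ t then f (t - i) else 0) * g i =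
      ∑ p ∈ Finset.HasAntidiagonal.antidiagonal t, f p.1 * g p.2 := by
  rw [Finset.Nat.sum_antidiagonal_eq_sum_range_succ (fun a b => f a * g b),
    ← Finset.sum_range_reflect,
    Fin.sum_univ_eq_sum_range (fun i => (if i ≤ t then f (t - i) else 0) * g i) m]
  have h1 : Finset.range (t + 1) ⊆ Finset.range m := Finset.range_mono ht
  rw [← Finset.sum_subset h1]
  · refine Finset.sum_congr rfl fun i hi => ?_
    have : i ≤ t := Nat.lt_succ_iff.1 (Finset.mem_range.1 hi)
    rw [if_pos this]
    congr 2
    omega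
  · intro i _ hi
    have : ¬ i ≤ t := fun h => hi (Finset.mem_range.2 (Nat.lt_succ_of_le h))
    rw [if_neg this, zero_mul]

/-- The condition `n ≤ t + 1` makes the reversed window fit above index `0`, so no coefficient is
cut off. -/
theorem sum_fin_ite_sub_sq {m t n : ℕ} (ht : t < m) (hn : n ≤ t + 1) (f : ℕ → ℝ)
    (hf : ∀ j, n ≤ j → f j = 0) :
    ∑ i : Fin m, (if i.1 ≤ t then f (t - i) else 0) ^ 2 = ∑ j ∈ Finset.range n, f j ^ 2 := by
  have h := sum_fin_ite_sub ht (fun j => f j ^ 2) 1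
  simp only [Pi.one_apply, mul_one] at h
  have e : ∀ i : Fin m, (if i.1 ≤ t then f (t - i) else 0) ^ 2 =
      if i.1 ≤ t then f (t - i) ^ 2 else 0 := fun i => by split_ifs <;> simp
  simp only [e]
  rw [h, Finset.Nat.sum_antidiagonal_eq_sum_range_succ (fun a _ => f a ^ 2)]
  refine (Finset.sum_subset (Finset.range_mono hn) fun j _ hj => ?_).symm
  rw [hf j (by simpa using hj)]
  simp

theorem abs_coeff_one_sub_X_pow_mul_le (h r : ℕ) (p : ℝ[X]) (hp : ∀ j, |p.coeff j| ≤ 1) (j : ℕ) :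
    |((1 - X ^ h) ^ r * p).coeff j| ≤ 2 ^ r := by
  induction r generalizing j with
  | zero => simpa using hp j
  | succ r ih =>
    rw [pow_succ', mul_assoc, sub_mul, one_mul, coeff_sub, coeff_X_pow_mul']
    refine (abs_sub _ _).trans ?_
    have h2 : |if h ≤ j then ((1 - X ^ h) ^ r * p).coeff (j - h) else 0| ≤ 2 ^ r := by
      split_ifs
      · exact ih _
      · simp
    rw [pow_succ]
    linarith [ih j]

/-- Smooth averages over disjoint blocks are well conditioned on the range of `Dʳ`: there are
normalized averages `M` such that `‖M Dʳ u‖ ≲ h⁻ʳ ‖u‖`, where `h` is the scale of the blocks. -/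
theorem exists_blockAverage (r h l m : ℕ) (hh : 1 ≤ h) (hm : l * ((r + 1) * h) ≤ m) :
    ∃ M : Matrix (Fin l) (Fin m) ℝ, (∀ b, ∑ i, M b i ^ 2 = 1) ∧
      (∀ b b' i, M b i ≠ 0 → M b' i ≠ 0 → b = b') ∧
      ∀ u : Fin m → ℝ, l2Norm (M *ᵥ (diffMatrix m ^ r *ᵥ u)) ^ 2 ≤
        ((r : ℝ) + 1) ^ 2 * 4 ^ r / (h : ℝ) ^ (2 * r) * l2Norm u ^ 2 := by
  set n : ℕ := (r + 1) * h with hn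
  have hn0 : 0 < n := by positivity
  have hh' : (0 : ℝ) < h := by exact_mod_cast hh
  have hn' : (0 : ℝ) < n := by exact_mod_cast hn0
  set g : ℝ[X] := ∑ j ∈ Finset.range h, X ^ j with hg
  have hgdeg : g.natDegree ≤ h - 1 := by
    refine natDegree_sum_le_of_forall_le _ _ fun j hj => ?_
    rw [natDegree_X_pow]
    have := Finset.mem_range.1 hj
    omega
  have hgcoeff : ∀ j, |g.coeff j| ≤ 1 := by
    intro j
    simp only [hg, finsetSum_coeff, coeff_X_pow, Finset.sum_ite_eq]
    split_ifs <;> simp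
  -- Since `(1 - X) g = 1 - X ^ h`, `r` of the `r + 1` factors telescope: `p` has mass `h ^ (r +
  -- 1)`, while `q = (1 - X) ^ r p` has coefficients at most `2 ^ r`. The spare factor spreads `q`
  -- over the block; with `g ^ r` the same estimate would lose a factor `h` in the squared norm.
  set p : ℝ[X] := g ^ (r + 1) with hp
  set q : ℝ[X] := (1 - X ^ h) ^ r * g with hq
  have hpq : (1 - X) ^ r * p = q := by
    have : (1 - X) * g = 1 - X ^ h := by rw [hg, mul_comm, geom_sum_mul_neg]
    rw [hp, hq, pow_succ, ← mul_assoc, ← mul_pow, this]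
  have hpz : ∀ j, n ≤ j → p.coeff j = 0 := by
    intro j hj
    refine coeff_eq_zero_of_natDegree_lt ?_
    have h1 : p.natDegree ≤ (r + 1) * (h - 1) := natDegree_pow_le.trans (by gcongr)
    have h2 : (r + 1) * (h - 1) < n := by
      rw [hn]; exact Nat.mul_lt_mul_of_pos_left (by omega) (by omega)
    omega
  have hqz : ∀ j, n ≤ j → q.coeff j = 0 := by
    intro j hj
    refine coeff_eq_zero_of_natDegree_lt ?_
    have h0 : (1 - X ^ h : ℝ[X]).natDegree ≤ h := by
      refine (natDegree_sub_le _ _).trans ?_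
      simp
    have h1 : q.natDegree ≤ r * h + (h - 1) := by
      refine natDegree_mul_le.trans (add_le_add ?_ hgdeg)
      exact natDegree_pow_le.trans (by gcongr)
    have h2 : n = r * h + h := by rw [hn]; ring
    omega
  have hqb : ∑ j ∈ Finset.range n, q.coeff j ^ 2 ≤ n * 4 ^ r := by
    have : ∀ j ∈ Finset.range n, q.coeff j ^ 2 ≤ 4 ^ r := by
      intro j _
      have := abs_coeff_one_sub_X_pow_mul_le h r g hgcoeff j
      rw [← sq_abs]
      calc _ ≤ ((2 : ℝ) ^ r) ^ 2 := by gcongr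
        _ = 4 ^ r := by rw [← pow_mul, mul_comm, pow_mul]; norm_num
    simpa using Finset.sum_le_card_nsmul _ _ _ this
  set S : ℝ := ∑ j ∈ Finset.range n, p.coeff j ^ 2 with hS
  have hpsum : ∑ j ∈ Finset.range n, p.coeff j = (h : ℝ) ^ (r + 1) := by
    have h1 : p.eval 1 = (h : ℝ) ^ (r + 1) := by simp [hp, hg, eval_finsetSum]
    rw [← h1, eval_eq_sum_range' (n := n)]
    · simp
    · by_contra hcon
      push Not at hcon
      have := hpz _ hcon
      have hp0 : p = 0 := leadingCoeff_eq_zero.1 this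
      rw [hp0, natDegree_zero] at hcon
      omega
  -- Cauchy–Schwarz on the `n` coefficients of `p`, whose sum is `p(1) = h ^ (r + 1)`.
  have hSlow : (h : ℝ) ^ (2 * r + 2) ≤ n * S := by
    have := sq_sum_le_card_mul_sum_sq (s := Finset.range n) (f := fun j => p.coeff j)
    rw [hpsum, Finset.card_range, ← pow_mul] at this
    convert! this using 2
    ring
  have hS0 : 0 < S := by
    have : 0 < (n : ℝ) * S := lt_of_lt_of_le (by positivity) hSlow
    exact (pos_iff_pos_of_mul_pos this).1 hn'
  -- The last index of block `b`: reading `n` coefficients backwards from it fills exactly that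
  -- block.
  let t : Fin l → ℕ := fun b => (b + 1) * n - 1
  have ht : ∀ b, t b < m := by
    intro b
    have h1 : (b.1 + 1) * n ≤ l * n := Nat.mul_le_mul_right _ b.2
    have h2 : 0 < (b.1 + 1) * n := by positivity
    simp only [t]
    omega
  have htn : ∀ b, n ≤ t b + 1 := by
    intro b
    have h1 : 1 * n ≤ (b.1 + 1) * n := Nat.mul_le_mul_right _ (by omega)
    simp only [t]
    omega
  have hblock : ∀ (f : ℕ → ℝ), (∀ j, n ≤ j → f j = 0) → ∀ (b : Fin l) (i : Fin m),
      (if i.1 ≤ t b then f (t b - i) else 0) ≠ 0 → i.1 / n = b := by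
    intro f hf b i hne
    have h1 : i.1 ≤ t b := by
      by_contra hcon
      exact hne (if_neg hcon)
    rw [if_pos h1] at hne
    have h2 : t b - i < n := by
      by_contra hcon
      exact hne (hf _ (not_lt.1 hcon))
    have h3 : (b.1 + 1) * n = b * n + n := by ring
    simp only [t] at h1 h2
    rw [Nat.div_eq_iff hn0]
    constructor <;> omega
  let M : Matrix (Fin l) (Fin m) ℝ :=
    Matrix.of fun b i => (if i.1 ≤ t b then p.coeff (t b - i) else 0) / √S
  refine ⟨M, ?_, ?_, ?_⟩
  · intro b
    simp only [M, Matrix.of_apply, div_pow, Real.sq_sqrt hS0.le, ← Finset.sum_div]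
    rw [sum_fin_ite_sub_sq (ht b) (htn b) _ hpz, div_self hS0.ne']
  · intro b b' i hb hb'
    have h1 := hblock _ hpz b i fun h0 => hb (by simp [M, h0])
    have h2 := hblock _ hpz b' i fun h0 => hb' (by simp [M, h0])
    exact Fin.ext (h1.symm.trans h2)
  · intro u
    -- Both sides are the coefficient of index `t b` in `p (1 - X) ^ r U = q U`, up to the factor `1
    -- / √S`: the differences move from `u` onto the row.
    have hMy : ∀ b, (M *ᵥ (diffMatrix m ^ r *ᵥ u)) b =
        (∑ i : Fin m, (if i.1 ≤ t b then q.coeff (t b - i) else 0) * u i) / √S := by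
      intro b
      have hY := diffMatrix_pow_mulVec_eq_coeff r (coeff_vecSeries u)
      simp only [Matrix.mulVec, dotProduct, M, Matrix.of_apply, div_mul_eq_mul_div,
        ← Finset.sum_div]
      congr 1
      have e1 := sum_fin_ite_sub (ht b) (fun j => p.coeff j)
        (fun i => PowerSeries.coeff i ((1 - PowerSeries.X) ^ r * vecSeries u))
      have e2 := sum_fin_ite_sub (ht b) (fun j => q.coeff j)
        (fun i => PowerSeries.coeff i (vecSeries u))
      simp only [hY, coeff_vecSeries] at e1 e2
      simp only [Matrix.mulVec, dotProduct] at e1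
      rw [e1, e2]
      simp only [← Polynomial.coeff_coe]
      rw [← PowerSeries.coeff_mul, ← PowerSeries.coeff_mul, ← mul_assoc, ← hpq]
      congr 2
      simp [mul_comm]
    have hsq : ∀ b, (M *ᵥ (diffMatrix m ^ r *ᵥ u)) b ^ 2 ≤
        n * 4 ^ r / S * ∑ i : Fin m with i.1 / n = b, u i ^ 2 := by
      intro b
      rw [hMy, div_pow, Real.sq_sqrt hS0.le, div_mul_eq_mul_div]
      gcongr
      have e : ∑ i : Fin m, (if i.1 ≤ t b then q.coeff (t b - i) else 0) * u i =
          ∑ i : Fin m with i.1 / n = b, (if i.1 ≤ t b then q.coeff (t b - i) else 0) * u i := by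
        refine (Finset.sum_subset (Finset.filter_subset _ _) fun i _ hi => ?_).symm
        by_contra hne
        exact hi (Finset.mem_filter.2 ⟨Finset.mem_univ _,
          hblock _ hqz b i (left_ne_zero_of_mul hne)⟩)
      rw [e]
      refine (Finset.sum_mul_sq_le_sq_mul_sq _ _ _).trans ?_
      gcongr
      refine le_trans ?_ hqb
      rw [← sum_fin_ite_sub_sq (ht b) (htn b) _ hqz]
      exact Finset.sum_le_sum_of_subset_of_nonneg (Finset.filter_subset _ _)
        fun i _ _ => sq_nonneg _
    have hblocks : ∑ b : Fin l, ∑ i : Fin m with i.1 / n = b, u i ^ 2 ≤ ∑ i, u i ^ 2 := by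
      simp only [Finset.sum_filter]
      rw [Finset.sum_comm]
      refine Finset.sum_le_sum fun i _ => ?_
      by_cases hi : i.1 / n < l
      · rw [Finset.sum_eq_single ⟨i.1 / n, hi⟩]
        · simp
        · intro b _ hb
          exact if_neg fun h => hb (Fin.ext h.symm)
        · simp
      · rw [Finset.sum_eq_zero]
        · positivity
        · intro b _
          exact if_neg fun h => hi (by rw [h]; exact b.2)
    rw [l2Norm_sq, l2Norm_sq]
    calc _ ≤ ∑ b : Fin l, n * 4 ^ r / S * ∑ i : Fin m with i.1 / n = b, u i ^ 2 :=
          Finset.sum_le_sum fun b _ => hsq b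
      _ ≤ n * 4 ^ r / S * ∑ i, u i ^ 2 := by
          rw [← Finset.mul_sum]; gcongr
      _ ≤ _ := by
          gcongr ?_ * _
          rw [div_le_div_iff₀ hS0 (by positivity)]
          have e : (n : ℝ) = (r + 1) * h := by rw [hn]; push_cast; ring
          have h1 : (h : ℝ) ^ (2 * r) * h ^ 2 ≤ (r + 1) * h * S := by
            rw [← e, ← pow_add]; exact hSlow
          have h2 : (h : ℝ) ^ (2 * r) * h ≤ (r + 1) * S := by
            refine le_of_mul_le_mul_right ?_ hh'
            nlinarith
          rw [e]
          calc ((r : ℝ) + 1) * h * 4 ^ r * h ^ (2 * r)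
              = (r + 1) * 4 ^ r * (h ^ (2 * r) * h) := by ring
            _ ≤ (r + 1) * 4 ^ r * ((r + 1) * S) := by gcongr
            _ = _ := by ring

end BlockAverage

/-! ### Stability of the greedy scheme -/

section Greedy

/-- Without overload `|x|` lies in a cell `[jδ, (j + 1)δ)` with `j < L`, whose midpoint is a level;
the nearest level is no farther away. -/
theorem abs_sub_le_of_isScalarQuantizer {δ : ℝ} (hδ : 0 < δ) {L : ℕ} {Q : ℝ → ℝ}
    (hQ : IsScalarQuantizer δ L Q) {x : ℝ} (hx : |x| < L * δ) : |x - Q x| ≤ δ / 2 := by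
  set j := ⌊|x| / δ⌋₊ with hj
  have h0 : 0 ≤ |x| / δ := by positivity
  have h1 : (j : ℝ) * δ ≤ |x| := (le_div_iff₀ hδ).1 (Nat.floor_le h0)
  have h2 : |x| < (j + 1) * δ := (div_lt_iff₀ hδ).1 (Nat.lt_floor_add_one _)
  have hjL : j < L := by
    rw [hj, Nat.floor_lt h0, div_lt_iff₀ hδ]
    exact hx
  rcases le_total 0 x with hs | hs
  · rw [abs_of_nonneg hs] at h1 h2
    refine ((hQ x).2 ((2 * j + 1) * δ / 2) ⟨j, hjL, Or.inl rfl⟩).trans (abs_le.2 ⟨?_, ?_⟩) <;>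
      linarith
  · rw [abs_of_nonpos hs] at h1 h2
    refine ((hQ x).2 (-((2 * j + 1) * δ / 2)) ⟨j, hjL, Or.inr rfl⟩).trans (abs_le.2 ⟨?_, ?_⟩) <;>
      linarith

/-- The state variable of the greedy scheme. -/
noncomputable def greedyState {m : ℕ} (Q : ℝ → ℝ) (r : ℕ) (y : Fin m → ℝ) : Fin m → ℝ :=
  fun i => greedyArg Q r y i - Q (greedyArg Q r y i)

theorem greedyArg_eq {m : ℕ} (Q : ℝ → ℝ) (r : ℕ) (y : Fin m → ℝ) (i : Fin m) :
    greedyArg Q r y i = (∑ j : Fin r, if h : j.1 + 1 ≤ i.1 then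
      (-1 : ℝ) ^ j.1 * (r.choose (j.1 + 1) : ℝ) *
        greedyState Q r y ⟨i.1 - (j.1 + 1), by omega⟩ else 0) + y i := by
  rw [greedyArg]
  rfl

/-- The noise-shaping identity: the feedback weights are the coefficients of `1 - (1 - X) ^ r`, so
the recursion says that the error is an `r`-th difference of the state. -/
theorem diffMatrix_pow_mulVec_greedyState {m : ℕ} (Q : ℝ → ℝ) (r : ℕ) (y : Fin m → ℝ) :
    diffMatrix m ^ r *ᵥ greedyState Q r y = y - greedyQuantize Q r y := by
  ext i
  rw [← diffMatrix_pow_mulVec_eq_coeff r (coeff_vecSeries _), coeff_one_sub_X_pow_mul,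
    coeff_vecSeries, Finset.sum_range]
  have h := greedyArg_eq Q r y i
  have hu : greedyState Q r y i = greedyArg Q r y i - greedyQuantize Q r y i := rfl
  rw [hu, h, Pi.sub_apply]
  have e : ∑ j : Fin r, (if j.1 + 1 ≤ i.1 then (-1 : ℝ) ^ (j.1 + 1) * (r.choose (j.1 + 1) : ℝ) *
      PowerSeries.coeff (i.1 - (j.1 + 1)) (vecSeries (greedyState Q r y)) else 0) =
      -∑ j : Fin r, if h : j.1 + 1 ≤ i.1 then (-1 : ℝ) ^ j.1 * (r.choose (j.1 + 1) : ℝ) *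
        greedyState Q r y ⟨i.1 - (j.1 + 1), by omega⟩ else 0 := by
    rw [← Finset.sum_neg_distrib]
    refine Finset.sum_congr rfl fun j _ => ?_
    split_ifs with hj
    · rw [← coeff_vecSeries (greedyState Q r y) ⟨i.1 - (j.1 + 1), by omega⟩, pow_succ]
      ring
    · simp
  rw [e]
  ring

theorem sum_choose_succ (r : ℕ) : ∑ j : Fin r, (r.choose (j.1 + 1) : ℝ) = 2 ^ r - 1 := by
  have h := Nat.sum_range_choose r
  rw [Finset.sum_range_succ'] at h
  rw [← Finset.sum_range (fun j => (r.choose (j + 1) : ℝ))]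
  have h' : (∑ j ∈ Finset.range r, (r.choose (j + 1) : ℝ)) + 1 = 2 ^ r := by
    rw [Nat.choose_zero_right] at h
    exact_mod_cast h
  linarith

/-- Stability of the greedy scheme with sufficiently many levels. -/
theorem abs_greedyState_le {m : ℕ} {δ : ℝ} (hδ : 0 < δ) {L : ℕ} {Q : ℝ → ℝ}
    (hQ : IsScalarQuantizer δ L Q) (r : ℕ) {y : Fin m → ℝ} {B : ℝ} (hy : ∀ i, |y i| ≤ B)
    (hL : levelBound r δ B ≤ L) (i : Fin m) : |greedyState Q r y i| ≤ δ / 2 := by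
  obtain ⟨i, hi⟩ := i
  induction i using Nat.strong_induction_on with
  | _ i ih =>
    refine abs_sub_le_of_isScalarQuantizer hδ hQ ?_
    rw [greedyArg_eq]
    -- The feedback has total weight `2 ^ r - 1` on earlier states, so the quantizer input stays
    -- below `B + (2 ^ r - 1) δ / 2 < L δ`.
    have h1 : |∑ j : Fin r, if h : j.1 + 1 ≤ i then (-1 : ℝ) ^ j.1 * (r.choose (j.1 + 1) : ℝ) *
        greedyState Q r y ⟨i - (j.1 + 1), by omega⟩ else 0| ≤ (2 ^ r - 1) * (δ / 2) := by
      refine (Finset.abs_sum_le_sum_abs _ _).trans ?_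
      rw [← sum_choose_succ, Finset.sum_mul]
      refine Finset.sum_le_sum fun j _ => ?_
      split_ifs with hj
      · rw [abs_mul, abs_mul, abs_pow, abs_neg, abs_one, one_pow, one_mul, Nat.abs_cast]
        gcongr
        exact ih _ (by omega) _
      · simp; positivity
    have h2 : B ≤ ⌈B / δ⌉₊ * δ := (div_le_iff₀ hδ).1 (Nat.le_ceil _)
    have h3 : ((⌈B / δ⌉₊ : ℝ) + 2 ^ r + 1) ≤ L := by exact_mod_cast hL
    have h4 := mul_le_mul_of_nonneg_right h3 hδ.le
    have h5 : (0 : ℝ) < 2 ^ r * δ := by positivity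
    refine (abs_add_le _ _).trans_lt ?_
    have h6 := hy ⟨i, hi⟩
    linarith

end Greedy

/-! ### Best approximations of perturbed sparse vectors -/

section BestApprox

/-- A best `s`-term approximation contains all the entries above a threshold, if at most `s`
entries are above it. -/
theorem subset_supp_of_isBestTermApprox {ι : Type*} [Fintype ι] [DecidableEq ι] {v w : ι → ℝ}
    {s : ℕ} {T : Finset ι} {θ : ℝ} (hθ : 0 ≤ θ) (hT : ∀ j ∈ T, θ < |v j|) (hTc : ∀ j ∉ T, |v j| ≤ θ)
    (hs : T.card ≤ s) (hw : IsBestTermApprox s v w) : T ⊆ supp w := by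
  have memsupp : ∀ (z : ι → ℝ) j, j ∈ supp z ↔ z j ≠ 0 := fun z j => by simp [supp]
  by_contra hsub
  obtain ⟨j, hjT, hjw⟩ := Finset.not_subset.1 hsub
  have hwj : w j = 0 := by
    by_contra h
    exact hjw ((memsupp w j).2 h)
  obtain ⟨w', hw'sp, hw'⟩ : ∃ w' : ι → ℝ, IsSparse s w' ∧ l2Norm (v - w') < l2Norm (v - w) := by
    have lt_of_sum : ∀ w' : ι → ℝ, ∑ i, (v i - w' i) ^ 2 < ∑ i, (v i - w i) ^ 2 →
        l2Norm (v - w') < l2Norm (v - w) := by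
      intro w' h
      refine lt_of_pow_lt_pow_left₀ 2 (l2Norm_nonneg _) ?_
      simpa only [l2Norm_sq, Pi.sub_apply] using h
    -- If `w` has room, coordinate `j` is added. Otherwise its support is at least as large as `T`
    -- but misses `j`, so it contains some `i ∉ T`, and exchanging `i` for `j` lowers the error.
    by_cases hcard : (supp w).card < s
    · have hvj : v j ≠ 0 := abs_pos.1 (hθ.trans_lt (hT j hjT))
      refine ⟨Function.update w j (v j), ?_, lt_of_sum _ ?_⟩
      · have : supp (Function.update w j (v j)) ⊆ insert j (supp w) := by
          intro i hi
          rw [memsupp] at hi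
          rw [Finset.mem_insert, memsupp]
          by_cases hij : i = j
          · exact Or.inl hij
          · rw [Function.update_of_ne hij] at hi
            exact Or.inr hi
        have h1 := Finset.card_le_card this
        have h2 := Finset.card_insert_le j (supp w)
        unfold IsSparse
        omega
      · refine Finset.sum_lt_sum (fun i _ => ?_) ⟨j, Finset.mem_univ _, ?_⟩
        · by_cases hij : i = j
          · subst hij
            simpa using sq_nonneg _
          · rw [Function.update_of_ne hij]
        · simpa [hwj] using pow_pos (abs_pos.2 hvj) 2
    · have hcard' : T.card ≤ (supp w).card := by omega
      obtain ⟨i, hiw, hiT⟩ : ∃ i ∈ supp w, i ∉ T := by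
        by_contra! hcon
        exact hjw (Finset.eq_of_subset_of_card_le hcon hcard' ▸ hjT)
      have hij : i ≠ j := fun h => hiT (h ▸ hjT)
      refine ⟨Function.update (Function.update w i 0) j (v j), ?_, lt_of_sum _ ?_⟩
      · have : supp (Function.update (Function.update w i 0) j (v j)) ⊆
            insert j ((supp w).erase i) := by
          intro l hl
          rw [memsupp] at hl
          rw [Finset.mem_insert, Finset.mem_erase, memsupp]
          by_cases hlj : l = j
          · exact Or.inl hlj
          · rw [Function.update_of_ne hlj] at hl
            by_cases hli : l = i
            · subst hli
              simp at hl
            · rw [Function.update_of_ne hli] at hl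
              exact Or.inr ⟨hli, hl⟩
        have h1 := Finset.card_le_card this
        have h2 := Finset.card_insert_le j ((supp w).erase i)
        have h3 := Finset.card_erase_add_one hiw
        have h4 : (supp w).card ≤ s := hw.1
        unfold IsSparse
        omega
      · have hdecomp : ∀ f : ι → ℝ, ∑ l, f l = f i + f j + ∑ l ∈ Finset.univ \ {i, j}, f l := by
          intro f
          rw [← Finset.sum_pair hij, add_comm]
          exact (Finset.sum_sdiff (Finset.subset_univ _)).symm
        rw [hdecomp, hdecomp (fun l => (v l - w l) ^ 2)]
        have hrest : ∑ l ∈ Finset.univ \ {i, j},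
            (v l - Function.update (Function.update w i 0) j (v j) l) ^ 2 =
            ∑ l ∈ Finset.univ \ {i, j}, (v l - w l) ^ 2 := by
          refine Finset.sum_congr rfl fun l hl => ?_
          simp only [Finset.mem_sdiff, Finset.mem_univ, true_and, Finset.mem_insert,
            Finset.mem_singleton, not_or] at hl
          rw [Function.update_of_ne hl.2, Function.update_of_ne hl.1]
        rw [hrest]
        simp only [Function.update_self, Function.update_of_ne hij, sub_self, sub_zero, hwj]
        have h1 : v i ^ 2 < v j ^ 2 := sq_lt_sq.2 ((hTc i hiT).trans_lt (hT j hjT))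
        nlinarith [sq_nonneg (v i - w i)]
  exact absurd (hw.2 w' hw'sp) (not_le.2 hw')

end BestApprox

/-! ### Sobolev duals -/

section SobolevDual

variable {m : ℕ} {ι : Type*} [Fintype ι] [DecidableEq ι]

theorem isUnit_transpose_mul_self {A : Matrix (Fin m) ι ℝ} {σ : ℝ} (hσ : 0 < σ)
    (hA : ∀ x, σ * l2Norm x ≤ l2Norm (A *ᵥ x)) : IsUnit (Aᵀ * A).det := by
  rw [isUnit_iff_ne_zero]
  intro h0
  obtain ⟨x, hx, hAx⟩ := Matrix.exists_mulVec_eq_zero_iff.2 h0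
  have h1 : A *ᵥ x = 0 := by
    have h2 : (A *ᵥ x) ⬝ᵥ (A *ᵥ x) = 0 := by
      rw [Matrix.dotProduct_mulVec, ← Matrix.mulVec_transpose, Matrix.mulVec_mulVec, hAx,
        zero_dotProduct]
    exact dotProduct_self_eq_zero.1 h2
  have h2 := hA x
  have h3 : l2Norm (A *ᵥ x) = 0 := by rw [h1]; simp [l2Norm]
  have h4 : 0 < l2Norm x := by
    rw [l2Norm, norm_pos_iff]
    intro h
    exact hx (by simpa using h)
  have := mul_pos hσ h4
  linarith

theorem leftPinv_mul_self {A : Matrix (Fin m) ι ℝ} (hA : IsUnit (Aᵀ * A).det) :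
    leftPinv A * A = 1 := by
  rw [leftPinv, Matrix.mul_assoc, Matrix.nonsing_inv_mul _ hA]

/-- `A *ᵥ (leftPinv A *ᵥ v)` is the orthogonal projection of `v` onto the range of `A`, hence no
longer than `v`. -/
theorem l2Norm_leftPinv_mulVec_le {A : Matrix (Fin m) ι ℝ} {σ : ℝ} (hσ : 0 < σ)
    (hA : ∀ x, σ * l2Norm x ≤ l2Norm (A *ᵥ x)) (v : Fin m → ℝ) :
    l2Norm (leftPinv A *ᵥ v) ≤ l2Norm v / σ := by
  have hu := isUnit_transpose_mul_self hσ hA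
  set x := leftPinv A *ᵥ v with hx
  have h1 : Aᵀ *ᵥ (A *ᵥ x) = Aᵀ *ᵥ v := by
    rw [hx, leftPinv, Matrix.mulVec_mulVec, Matrix.mulVec_mulVec, ← Matrix.mul_assoc,
      Matrix.mul_nonsing_inv _ hu, Matrix.one_mul]
  have h2 : (A *ᵥ x) ⬝ᵥ (A *ᵥ x) = (A *ᵥ x) ⬝ᵥ v := by
    have key : ∀ z, x ⬝ᵥ (Aᵀ *ᵥ z) = (A *ᵥ x) ⬝ᵥ z := fun z => by
      rw [Matrix.dotProduct_mulVec, Matrix.vecMul_transpose]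
    rw [← key, h1, key]
  have h3 : l2Norm (A *ᵥ x) ≤ l2Norm v := by
    have h4 : l2Norm (A *ᵥ x) ^ 2 ≤ l2Norm (A *ᵥ x) * l2Norm v := by
      have e : l2Norm (A *ᵥ x) ^ 2 = (A *ᵥ x) ⬝ᵥ v := by
        rw [← h2, l2Norm_sq]
        simp [dotProduct, sq]
      rw [e]
      have := real_inner_le_norm (WithLp.toLp 2 v) (WithLp.toLp 2 (A *ᵥ x))
      rw [EuclideanSpace.inner_toLp_toLp, star_trivial, mul_comm] at this
      exact this
    rcases (l2Norm_nonneg (A *ᵥ x)).eq_or_lt with h0 | h0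
    · rw [← h0]; exact l2Norm_nonneg _
    · rw [sq] at h4
      exact le_of_mul_le_mul_left h4 h0
  rw [le_div_iff₀ hσ, mul_comm]
  exact (hA x).trans h3

theorem sobolevDual_mul_self {r : ℕ} {E : Matrix (Fin m) ι ℝ} {σ : ℝ} (hσ : 0 < σ)
    (hE : ∀ x, σ * l2Norm x ≤ l2Norm (((diffMatrix m ^ r)⁻¹ * E) *ᵥ x)) :
    sobolevDual r E * E = 1 := by
  rw [sobolevDual, Matrix.mul_assoc, leftPinv_mul_self (isUnit_transpose_mul_self hσ hE)]

/-- Reconstruction error of the Sobolev dual in terms of the state variable. -/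
theorem l2Norm_sub_sobolevDual_mulVec_le {r : ℕ} {E : Matrix (Fin m) ι ℝ} {σ : ℝ} (hσ : 0 < σ)
    (hE : ∀ x, σ * l2Norm x ≤ l2Norm (((diffMatrix m ^ r)⁻¹ * E) *ᵥ x)) (x : ι → ℝ)
    (q u : Fin m → ℝ) (hu : diffMatrix m ^ r *ᵥ u = E *ᵥ x - q) :
    l2Norm (x - sobolevDual r E *ᵥ q) ≤ l2Norm u / σ := by
  have h1 : x - sobolevDual r E *ᵥ q = leftPinv ((diffMatrix m ^ r)⁻¹ * E) *ᵥ u := by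
    have e1 : u = (diffMatrix m ^ r)⁻¹ *ᵥ (E *ᵥ x - q) := by
      rw [← hu, Matrix.mulVec_mulVec, Matrix.nonsing_inv_mul _ (isUnit_det_diffMatrix_pow m r),
        Matrix.one_mulVec]
    rw [e1, Matrix.mulVec_mulVec, ← sobolevDual, Matrix.mulVec_sub, Matrix.mulVec_mulVec,
      sobolevDual_mul_self hσ hE, Matrix.one_mulVec]
  rw [h1]
  exact l2Norm_leftPinv_mulVec_le hσ hE u

end SobolevDual

/-! ### Sub-Gaussian matrices: entries, block averages and rows -/

section SubGaussianMatrix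

open Real
open scoped NNReal ENNReal

variable {Ω : Type*} [MeasurableSpace Ω] {P : Measure Ω} {m N : ℕ}

theorem SigmaDelta.IsSubGaussianMatrix.isStdSubgaussianFamily [IsProbabilityMeasure P]
    {Φ : Ω → Matrix (Fin m) (Fin N) ℝ} {c : ℝ} (hc : 0 < c) (h : IsSubGaussianMatrix P Φ c 0 1) :
    IsStdSubgaussianFamily P (fun (p : Fin m × Fin N) ω => Φ ω p.1 p.2)
      ⟨18 * c ^ 2, by positivity⟩ where
  measurable p := h.measurable p.1 p.2
  indep := h.indep
  mgf p := hasSubgaussianMGF_of_isSubGaussianVar hc (h.measurable _ _) (h.subGaussian p.1 p.2)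
    (h.mean _ _)
  mean _ := h.mean _ _
  variance _ := h.variance _ _

/-- Left multiplication by a matrix with normalized rows of disjoint supports. -/
theorem IsStdSubgaussianFamily.matrix_mul {Φ : Ω → Matrix (Fin m) (Fin N) ℝ} {τ : ℝ≥0}
    (h : IsStdSubgaussianFamily P (fun (p : Fin m × Fin N) ω => Φ ω p.1 p.2) τ) {l : ℕ}
    (M : Matrix (Fin l) (Fin m) ℝ) (hM : ∀ b, ∑ i, M b i ^ 2 = 1)
    (hdisj : ∀ b b' i, M b i ≠ 0 → M b' i ≠ 0 → b = b') :
    IsStdSubgaussianFamily P (fun (p : Fin l × Fin N) ω => (M * Φ ω) p.1 p.2) τ := by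
  classical
  have := h.blockSum (fun p : Fin l × Fin N => (Finset.univ.filter fun i => M p.1 i ≠ 0) ×ˢ {p.2})
    (fun p q hpq => by
      simp only [Function.onFun, Finset.disjoint_left, Finset.mem_product, Finset.mem_singleton,
        Finset.mem_filter, Finset.mem_univ, true_and]
      rintro t ⟨h1, h2⟩ ⟨h3, h4⟩
      exact hpq (Prod.ext (hdisj _ _ _ h1 h3) (h2.symm.trans h4))) (fun p t => M p.1 t.1)
    (fun p => by
      simp only [Finset.sum_product, Finset.sum_singleton]
      rw [← hM p.1, Finset.sum_filter_of_ne]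
      intro i _ hi h0
      simp [h0] at hi)
  convert! this using 3 with p ω
  simp only [Finset.sum_product, Finset.sum_singleton]
  rw [Finset.sum_filter_of_ne]
  · rfl
  · intro i _ hi h0
    simp [h0] at hi

/-- Lets a union over the `m ≤ N` rows be absorbed into the entropy of the supports. -/
theorem natCast_le_exp_mul_log {k N : ℕ} (hk : 1 ≤ k) (hkN : k ≤ N) :
    (N : ℝ) ≤ rexp (k * log (rexp 1 * N / k)) := by
  have hk' : (1 : ℝ) ≤ k := by exact_mod_cast hk
  have hk0 : (0 : ℝ) < k := by linarith
  have hN0 : (0 : ℝ) < N := by exact_mod_cast hk.trans hkN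
  rw [← Real.log_le_iff_le_exp hN0]
  have e : log (rexp 1 * N / k) = 1 + log (N / k) := by
    rw [mul_div_assoc, Real.log_mul (exp_pos 1).ne' (by positivity), Real.log_exp]
  have e2 : log N = log (N / k) + log k := by
    rw [← Real.log_mul (by positivity) (by positivity), div_mul_cancel₀ _ hk0.ne']
  have h1 : 0 ≤ log ((N : ℝ) / k) := Real.log_nonneg (by
    rw [le_div_iff₀ hk0, one_mul]; exact_mod_cast hkN)
  have h2 : log k ≤ k := (Real.log_le_self hk0.le)
  rw [e, e2]
  nlinarith

/-- Cauchy-Schwarz for a row applied to a vector supported on `T`. -/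
theorem sq_mulVec_le_of_supp_subset (A : Matrix (Fin m) (Fin N) ℝ) {x : Fin N → ℝ}
    {T : Finset (Fin N)} (hx : supp x ⊆ T) (i : Fin m) :
    (A *ᵥ x) i ^ 2 ≤ (∑ j : T, A i j ^ 2) * l2Norm x ^ 2 := by
  rw [← columns_mulVec_restrict A hx, ← l2Norm_restrict hx, l2Norm_sq]
  exact Finset.sum_mul_sq_le_sq_mul_sq _ _ _

/-- Uniform bound on the measurements of sparse vectors. -/
theorem SigmaDelta.IsSubGaussianMatrix.measureReal_exists_sq_mulVec_gt_le
    [IsProbabilityMeasure P]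
    {Φ : Ω → Matrix (Fin m) (Fin N) ℝ} {c : ℝ} (hc : 0 < c) (h : IsSubGaussianMatrix P Φ c 0 1)
    {k : ℕ} (hk : 1 ≤ k) (hkN : k ≤ N) (hmN : m ≤ N) (v : ℝ) :
    P.real {ω | ∃ x, IsSparse k x ∧ ∃ i, v * l2Norm x ^ 2 < (Φ ω *ᵥ x) i ^ 2} ≤
      rexp (4 * (k * log (rexp 1 * N / k)) - v / (4 * c ^ 2)) := by
  classical
  -- Cauchy–Schwarz in one row removes `x` and leaves a sum of `k` squares, so no net is needed,
  -- only a union over rows and supports. The `4` in the exponent is `1` for rows, `1` for supports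
  -- and `2` for the moment bound `exp 2`.
  have hsub : {ω | ∃ x, IsSparse k x ∧ ∃ i, v * l2Norm x ^ 2 < (Φ ω *ᵥ x) i ^ 2} ⊆
      ⋃ p ∈ (Finset.univ : Finset (Fin m)) ×ˢ
          Finset.powersetCard k (Finset.univ : Finset (Fin N)),
        {ω | v / (4 * c ^ 2) ≤ ∑ j : p.2, Φ ω p.1 j ^ 2 / (4 * c ^ 2)} := by
    rintro ω ⟨x, hx, i, hlt⟩
    obtain ⟨T, hT, hxT⟩ := exists_superset_of_isSparse hx hkN
    refine Set.mem_biUnion (x := (i, T)) (Finset.mem_product.2 ⟨Finset.mem_univ _, hT⟩) ?_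
    have h1 := hlt.trans_le (sq_mulVec_le_of_supp_subset (Φ ω) hxT i)
    have h2 := lt_of_mul_lt_mul_right h1 (sq_nonneg _)
    simp only [Set.mem_ofPred_eq, ← Finset.sum_div]
    gcongr
  have hp : ∀ p ∈ (Finset.univ : Finset (Fin m)) ×ˢ
          Finset.powersetCard k (Finset.univ : Finset (Fin N)),
      P.real {ω | v / (4 * c ^ 2) ≤ ∑ j : p.2, Φ ω p.1 j ^ 2 / (4 * c ^ 2)} ≤
        rexp (k * 2 - v / (4 * c ^ 2)) := by
    rintro ⟨i, T⟩ hT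
    have hind : iIndepFun (fun (j : T) ω => Φ ω i j ^ 2 / (4 * c ^ 2)) P :=
      (h.indep.precomp (g := fun j : T => (i, (j : Fin N))) fun a b hab =>
        Subtype.ext (Prod.mk.inj hab).2).comp (fun _ x => x ^ 2 / (4 * c ^ 2))
        fun _ => by fun_prop
    have hmom := fun j : T => integral_exp_sq_le_of_isSubGaussianVar hc (h.measurable i j)
      (h.subGaussian i j)
    have := chernoff_of_iIndepFun hind
      (fun j => ((h.measurable i j).pow_const 2).div_const _) (fun j => (hmom j).1)
      (fun j => (hmom j).2) (v / (4 * c ^ 2))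
    rwa [Fintype.card_coe, (Finset.mem_powersetCard.1 (Finset.mem_product.1 hT).2).2] at this
  have hL := one_le_log_exp_mul_div hk hkN
  have hkL : (k : ℝ) ≤ k * log (rexp 1 * N / k) := le_mul_of_one_le_right (Nat.cast_nonneg _) hL
  calc _ ≤ _ := measureReal_mono hsub (measure_ne_top _ _)
    _ ≤ _ := measureReal_biUnion_finset_le _ _
    _ ≤ (m * N.choose k : ℝ) * rexp (k * 2 - v / (4 * c ^ 2)) := by
      refine (Finset.sum_le_card_nsmul _ _ _ hp).trans (le_of_eq ?_)
      rw [nsmul_eq_mul, Finset.card_product, Finset.card_powersetCard, Finset.card_univ,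
        Fintype.card_fin, Finset.card_univ, Fintype.card_fin]
      push_cast
      ring
    _ ≤ (rexp (k * log (rexp 1 * N / k)) * rexp (k * log (rexp 1 * N / k))) *
        rexp (k * 2 - v / (4 * c ^ 2)) := by
      gcongr
      · exact le_trans (by exact_mod_cast hmN) (natCast_le_exp_mul_log hk hkN)
      · exact choose_le_exp_mul_log hk hkN
    _ ≤ _ := by
      rw [← Real.exp_add, ← Real.exp_add]
      exact exp_le_exp.2 (by linarith)

/-- Measurements of sparse vectors by matrices with bounded entries. -/
theorem abs_mulVec_le_of_abs_le (A : Matrix (Fin m) (Fin N) ℝ) {K : ℝ} (hA : ∀ i j, |A i j| ≤ K)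
    {k : ℕ} {z : Fin N → ℝ} (hz : IsSparse k z) (hK : 0 ≤ K) (i : Fin m) :
    |(A *ᵥ z) i| ≤ K * √k * l2Norm z := by
  refine abs_le_of_sq_le_sq ?_ (by have := l2Norm_nonneg z; positivity)
  refine (sq_mulVec_le_of_supp_subset A (Finset.Subset.refl (supp z)) i).trans ?_
  rw [mul_pow, mul_pow, Real.sq_sqrt (Nat.cast_nonneg k)]
  gcongr
  have h1 : ∀ j ∈ (Finset.univ : Finset (supp z)), A i j ^ 2 ≤ K ^ 2 := fun j _ =>
    sq_le_sq' (abs_le.1 (hA i j)).1 (abs_le.1 (hA i j)).2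
  refine (Finset.sum_le_card_nsmul _ _ _ h1).trans ?_
  rw [nsmul_eq_mul, Finset.card_univ, Fintype.card_coe, mul_comm]
  gcongr
  exact_mod_cast hz

end SubGaussianMatrix

/-! ### Restricted isometry constants and robust recovery -/

section Recovery

variable {m N : ℕ}

/-- A real infimum is bounded by a member only if the set is bounded below; a coordinate vector,
which is sparse since `s ≥ 1`, forces every admissible constant to be nonnegative. -/
theorem ripConst_le {s : ℕ} (hs : 1 ≤ s) (hN : 0 < N) (A : Matrix (Fin m) (Fin N) ℝ) {γ : ℝ}
    (h : ∀ x, IsSparse s x → |l2Norm (A *ᵥ x) ^ 2 - l2Norm x ^ 2| ≤ γ * l2Norm x ^ 2) :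
    ripConst s A ≤ γ := by
  refine csInf_le ⟨0, ?_⟩ ?_
  · intro γ' hγ'
    have hsp : IsSparse s (Pi.single (⟨0, hN⟩ : Fin N) (1 : ℝ)) := by
      refine le_trans (Finset.card_le_card (t := {⟨0, hN⟩}) ?_) (by simpa using hs)
      intro j hj
      rw [Finset.mem_singleton]
      by_contra hne
      simp [supp, hne] at hj
    have h1 := hγ' _ hsp
    have h2 : l2Norm (Pi.single (⟨0, hN⟩ : Fin N) (1 : ℝ)) ^ 2 = 1 := by
      rw [l2Norm_sq, Finset.sum_eq_single ⟨0, hN⟩] <;> simp +contextual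
    rw [h2] at h1
    linarith [h1.1, h1.2]
  · intro x hx
    have := abs_le.1 (h x hx)
    constructor <;> linarith [this.1, this.2]

theorem abs_le_l2Norm {ι : Type*} [Fintype ι] (v : ι → ℝ) (j : ι) : |v j| ≤ l2Norm v := by
  refine abs_le_of_sq_le_sq ?_ (l2Norm_nonneg _)
  rw [l2Norm_sq]
  exact Finset.single_le_sum (f := fun i => v i ^ 2) (fun i _ => sq_nonneg _) (Finset.mem_univ j)

theorem l2Norm_le_sqrt_mul {v : Fin m → ℝ} {b : ℝ} (hb : 0 ≤ b) (h : ∀ i, |v i| ≤ b) :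
    l2Norm v ≤ √m * b := by
  refine le_of_sq_le_sq ?_ (by positivity)
  rw [l2Norm_sq, mul_pow, Real.sq_sqrt (Nat.cast_nonneg m)]
  have h1 : ∀ i ∈ (Finset.univ : Finset (Fin m)), v i ^ 2 ≤ b ^ 2 := fun i _ =>
    sq_le_sq' (abs_le.1 (h i)).1 (abs_le.1 (h i)).2
  simpa using Finset.sum_le_card_nsmul _ _ _ h1

/-- Error of a robust decoder applied to the greedily quantized measurements. -/
theorem l2Norm_sub_decoder_le (hm : 0 < m) (hN : 0 < N) {k a r : ℕ} (hk : 1 ≤ k) (ha : 1 ≤ a)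
    {γ C : ℝ} (hγ : 0 < γ) {Δ : Matrix (Fin m) (Fin N) ℝ → (Fin m → ℝ) → (Fin N → ℝ)}
    (hΔ : IsRobustDecoder Δ k a γ C) {A : Matrix (Fin m) (Fin N) ℝ}
    (hA : ∀ x, IsSparse (a * k) x →
      |l2Norm (A *ᵥ x) ^ 2 / m - l2Norm x ^ 2| ≤ γ / 2 * l2Norm x ^ 2)
    {δ : ℝ} (hδ : 0 < δ) {z : Fin N → ℝ} (hz : IsSparse k z) {q u : Fin m → ℝ}
    (hu : diffMatrix m ^ r *ᵥ u = A *ᵥ z - q) (hub : ∀ i, |u i| ≤ δ / 2) :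
    l2Norm (z - Δ ((√m)⁻¹ • A) ((√m)⁻¹ • q)) ≤ C * (2 ^ r * (δ / 2)) := by
  have hm' : (0 : ℝ) < m := by exact_mod_cast hm
  have hsm : 0 < √(m : ℝ) := Real.sqrt_pos.2 hm'
  have hsmul : ∀ v : Fin m → ℝ, l2Norm ((√m)⁻¹ • v) = (√m)⁻¹ * l2Norm v := by
    intro v
    rw [l2Norm, WithLp.toLp_smul, norm_smul, Real.norm_of_nonneg (by positivity)]
    rfl
  have hrip : ripConst (a * k) ((√m)⁻¹ • A) < γ := by
    refine (ripConst_le (Nat.mul_pos ha hk) hN _ fun x hx => ?_).trans_lt (half_lt_self hγ)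
    rw [Matrix.smul_mulVec, hsmul, mul_pow, inv_pow, Real.sq_sqrt hm'.le, ← div_eq_inv_mul]
    exact hA x hx
  have he := hΔ _ hrip (2 ^ r * (δ / 2)) (by positivity) z hz ((√m)⁻¹ • (q - A *ᵥ z)) (by
    rw [hsmul, ← div_eq_inv_mul, div_le_iff₀ hsm, mul_comm]
    refine l2Norm_le_sqrt_mul (by positivity) fun i => ?_
    have := abs_diffMatrix_pow_mulVec_le r hub i
    rw [hu] at this
    rwa [Pi.sub_apply, abs_sub_comm])
  have e : ((√m)⁻¹ • A) *ᵥ z + (√m)⁻¹ • (q - A *ᵥ z) = (√(m : ℝ))⁻¹ • q := by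
    rw [Matrix.smul_mulVec, ← smul_add, add_sub_cancel]
  rwa [e] at he

/-- Best approximations of a vector close to one with large nonzero entries. -/
theorem supp_subset_of_isBestTermApprox_of_close {z v w : Fin N → ℝ} {s : ℕ} {θ : ℝ}
    (hzv : l2Norm (z - v) ≤ θ) (hz : ∀ j ∈ supp z, 2 * θ < |z j|) (hs : (supp z).card ≤ s)
    (hw : IsBestTermApprox s v w) : supp z ⊆ supp w := by
  have hclose : ∀ j, |z j - v j| ≤ θ := fun j => (abs_le_l2Norm (z - v) j).trans hzv
  refine subset_supp_of_isBestTermApprox ((l2Norm_nonneg _).trans hzv) (fun j hj => ?_)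
    (fun j hj => ?_) hs hw
  · have h1 := abs_sub_abs_le_abs_sub (z j) (v j)
    linarith [hz j hj, hclose j]
  · have h0 : z j = 0 := by
      by_contra h
      exact hj (by simp [supp, h])
    have := hclose j
    rwa [h0, zero_sub, abs_neg] at this

end Recovery

/-! ### The event on which quantization and recovery succeed -/

section GoodEvent

open Real
open scoped NNReal ENNReal

variable {m N : ℕ}

/-- The restricted isometry property of block averages bounds `D⁻ʳ A` from below on sparse
vectors. -/
theorem mul_l2Norm_le_of_blockAverage {r h l k : ℕ} (hh : 1 ≤ h) (hl : 0 < l)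
    {A : Matrix (Fin m) (Fin N) ℝ} {M : Matrix (Fin l) (Fin m) ℝ}
    (hM : ∀ u : Fin m → ℝ, l2Norm (M *ᵥ (diffMatrix m ^ r *ᵥ u)) ^ 2 ≤
        ((r : ℝ) + 1) ^ 2 * 4 ^ r / (h : ℝ) ^ (2 * r) * l2Norm u ^ 2)
    (hMA : ∀ x, IsSparse k x →
      |l2Norm ((M * A) *ᵥ x) ^ 2 / l - l2Norm x ^ 2| ≤ 1 / 2 * l2Norm x ^ 2)
    {σ : ℝ} (hσ : σ ^ 2 * (2 * ((r : ℝ) + 1) ^ 2 * 4 ^ r) ≤ (h : ℝ) ^ (2 * r) * l)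
    {x : Fin N → ℝ} (hx : IsSparse k x) {u : Fin m → ℝ} (hu : diffMatrix m ^ r *ᵥ u = A *ᵥ x) :
    σ * l2Norm x ≤ l2Norm u := by
  have hl' : (0 : ℝ) < l := by exact_mod_cast hl
  have hh' : (0 : ℝ) < h := by exact_mod_cast hh
  refine le_of_sq_le_sq ?_ (l2Norm_nonneg _)
  have h1 := hM u
  rw [hu, Matrix.mulVec_mulVec, div_mul_eq_mul_div, le_div_iff₀ (by positivity)] at h1
  have h2 : 1 / 2 * l2Norm x ^ 2 * l ≤ l2Norm ((M * A) *ᵥ x) ^ 2 := by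
    rw [← le_div_iff₀ hl']
    linarith [(abs_le.1 (hMA x hx)).1]
  have h3 : 0 < ((r : ℝ) + 1) ^ 2 * 4 ^ r := by positivity
  refine le_of_mul_le_mul_left ?_ h3
  calc ((r : ℝ) + 1) ^ 2 * 4 ^ r * (σ * l2Norm x) ^ 2
      = σ ^ 2 * (2 * ((r : ℝ) + 1) ^ 2 * 4 ^ r) * (l2Norm x ^ 2 / 2) := by ring
    _ ≤ (h : ℝ) ^ (2 * r) * l * (l2Norm x ^ 2 / 2) := by gcongr
    _ = 1 / 2 * l2Norm x ^ 2 * l * (h : ℝ) ^ (2 * r) := by ring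
    _ ≤ l2Norm ((M * A) *ᵥ x) ^ 2 * (h : ℝ) ^ (2 * r) := by gcongr
    _ ≤ _ := h1

/-- Block length and number of blocks for measurements of oversampling ratio `lam`. -/
theorem exists_block_sizes {r m : ℕ} {β X : ℝ} (hβ : 1 ≤ β) (hm : X * β = m)
    (hX : (r : ℝ) + 1 ≤ X) :
    ∃ h l : ℕ, 1 ≤ h ∧ 0 < l ∧ l * ((r + 1) * h) ≤ m ∧ β ≤ 2 * h ∧ X ≤ 2 * (r + 1) * l := by
  have hβ0 : 0 ≤ β := by linarith
  -- Both `β` and `m / ((r + 1) h)` are at least `1`, so each floor loses at most a factor `2`.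
  set h := ⌊β⌋₊ with hh
  have h1 : 1 ≤ h := Nat.le_floor (by simpa using hβ)
  have hle : (h : ℝ) ≤ β := Nat.floor_le hβ0
  have hlt : β < h + 1 := Nat.lt_floor_add_one β
  have h1' : (1 : ℝ) ≤ h := by exact_mod_cast h1
  have hn0 : 0 < (r + 1) * h := by positivity
  have hnm : (r + 1) * h ≤ m := by
    have : (((r + 1) * h : ℕ) : ℝ) ≤ m := by
      push_cast
      rw [← hm]
      exact mul_le_mul hX hle (by positivity) (by linarith)
    exact_mod_cast this
  set l := m / ((r + 1) * h) with hl
  have hl0 : 0 < l := Nat.div_pos hnm hn0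
  refine ⟨h, l, h1, hl0, Nat.div_mul_le_self _ _, by linarith, ?_⟩
  have h2 : m < (l + 1) * ((r + 1) * h) := by
    rw [← Nat.div_lt_iff_lt_mul hn0]
    exact Nat.lt_succ_self _
  have h3 : (l + 1) * ((r + 1) * h) ≤ (2 * l) * ((r + 1) * h) := by
    gcongr
    omega
  have h4 : (m : ℝ) ≤ 2 * l * ((r + 1) * h) := by exact_mod_cast (h2.trans_le h3).le
  have hβpos : 0 < β := by linarith
  refine le_of_mul_le_mul_right ?_ hβpos
  calc X * β = m := hm
    _ ≤ 2 * l * ((r + 1) * h) := h4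
    _ ≤ 2 * l * ((r + 1) * β) := by gcongr
    _ = _ := by ring

/-- The exponent `m ^ (1 - α) * k ^ α` in terms of the oversampling ratio. -/
theorem rpow_mul_rpow_eq {m k α : ℝ} (hm : 0 < m) (hk : 0 < k) :
    m ^ (1 - α) * k ^ α = k * (m / k) ^ (1 - α) ∧ m ^ (1 - α) * k ^ α * (m / k) ^ α = m := by
  constructor
  · rw [Real.div_rpow hm.le hk.le, Real.rpow_sub hk, Real.rpow_one]
    field_simp
  · rw [Real.div_rpow hm.le hk.le, Real.rpow_sub hm, Real.rpow_one]
    field_simp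

/-- Squared form of the uniform bound on the measurements. -/
theorem sq_measurement_bound {m lam α X t : ℝ} (hlam : 0 < lam) (hX : X * lam ^ α = m)
    (hm : 0 ≤ m) :
    (rexp (1 / 2) * √m * lam ^ (-α / 2) * t) ^ 2 = rexp 1 * X * t ^ 2 := by
  rw [mul_pow, mul_pow, mul_pow, Real.sq_sqrt hm]
  have e1 : rexp (1 / 2) ^ 2 = rexp 1 := by
    rw [← Real.exp_nat_mul]; congr 1; norm_num
  have e2 : (lam ^ (-α / 2)) ^ 2 = (lam ^ α)⁻¹ := by
    rw [← Real.rpow_natCast, ← Real.rpow_mul hlam.le, ← Real.rpow_neg hlam.le]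
    congr 1
    push_cast
    ring
  have : lam ^ α ≠ 0 := by positivity
  rw [e1, e2, ← hX]
  field_simp

/-- The lower bound for `D⁻ʳ A` obtained from blocks of the given sizes. -/
theorem sq_lower_bound_le {r h l : ℕ} {m lam α X : ℝ} (hlam : 0 < lam) (hX : X * lam ^ α = m)
    (hm : 0 ≤ m) (hh : lam ^ α ≤ 2 * h) (hl : X ≤ 2 * (r + 1) * l) :
    (√m * lam ^ (α * ((r : ℝ) - 1 / 2)) / (2 * ((r : ℝ) + 1) ^ 2 * 4 ^ r)) ^ 2 *
      (2 * ((r : ℝ) + 1) ^ 2 * 4 ^ r) ≤ (h : ℝ) ^ (2 * r) * l := by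
  have e1 : (lam ^ (α * ((r : ℝ) - 1 / 2))) ^ 2 * lam ^ α = (lam ^ α) ^ (2 * r) := by
    rw [← Real.rpow_natCast, ← Real.rpow_natCast, ← Real.rpow_mul hlam.le,
      ← Real.rpow_mul hlam.le, ← Real.rpow_add hlam]
    congr 1
    push_cast
    ring
  have e2 : (2 : ℝ) ^ (2 * r) = 4 ^ r := by rw [pow_mul]; norm_num
  have hr0 : (0 : ℝ) ≤ r := Nat.cast_nonneg r
  have h2 : 2 * ((r : ℝ) + 1) ≤ 2 * (r + 1) ^ 2 := by nlinarith
  have hβ : 0 < lam ^ α := by positivity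
  set D : ℝ := 2 * ((r : ℝ) + 1) ^ 2 * 4 ^ r with hD
  have hD0 : 0 < D := by positivity
  rw [div_pow, mul_pow, Real.sq_sqrt hm, div_mul_eq_mul_div, div_le_iff₀ (by positivity), ← hX]
  calc X * lam ^ α * (lam ^ (α * ((r : ℝ) - 1 / 2))) ^ 2 * D
      = X * (lam ^ α) ^ (2 * r) * D := by rw [← e1]; ring
    _ ≤ (2 * (r + 1) * l) * (2 * h) ^ (2 * r) * D := by gcongr
    _ = (h : ℝ) ^ (2 * r) * l * (2 * (r + 1) * 4 ^ r * D) := by rw [mul_pow, e2]; ring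
    _ ≤ (h : ℝ) ^ (2 * r) * l * (2 * (r + 1) ^ 2 * 4 ^ r * D) := by gcongr
    _ = _ := by rw [sq D, hD]

/-- The union bound produces prefactor `2 + 2 + 1 = 5`; giving up half of the rate brings it
strictly below `4`. -/
theorem lt_four_mul_exp_of_le_five_mul_exp {p x : ℝ} (hx : 1 ≤ x) (h : p ≤ 5 * rexp (-(2 * x))) :
    p < 4 * rexp (-x) := by
  have h3 : rexp (-(2 * x)) = rexp (-x) * rexp (-x) := by
    rw [← Real.exp_add]; congr 1; ring
  have h4 : rexp (-x) ≤ 1 / 2 := by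
    rw [Real.exp_neg, inv_eq_one_div]
    have := add_one_le_exp x
    gcongr
    linarith
  have h5 := exp_pos (-x)
  rw [h3] at h
  nlinarith

/-- With overwhelming probability, a sub-Gaussian matrix has the restricted isometry property,
`D⁻ʳ Φ` is bounded below on sparse vectors, and the measurements are uniformly bounded. -/
theorem exists_good_event.{u} (r a : ℕ) (ha : 1 ≤ a) {γ : ℝ} (hγ0 : 0 < γ) (hγ1 : γ < 1)
    {c : ℝ} (hc : 0 < c) :
    ∃ C₁ C₂ : ℝ, 0 < C₁ ∧ 0 < C₂ ∧
      ∀ (α : ℝ), 0 < α → α < 1 → ∀ (k m N : ℕ), 1 ≤ k → k < m → m < N →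
      (C₁ * log (rexp 1 * N / k)) ^ (1 / (1 - α)) ≤ (m : ℝ) / k →
      ∀ (Ω : Type u) [MeasurableSpace Ω] (P : Measure Ω) [IsProbabilityMeasure P]
        (Φ : Ω → Matrix (Fin m) (Fin N) ℝ), IsSubGaussianMatrix P Φ c 0 1 → ∀ K : ℝ,
      ∃ G : Set Ω, MeasurableSet G ∧
        1 - 4 * rexp (-C₂ * (m : ℝ) ^ (1 - α) * (k : ℝ) ^ α) < P.real G ∧
        ∀ ω ∈ G,
          (∀ x, IsSparse (a * k) x →
            |l2Norm (Φ ω *ᵥ x) ^ 2 / m - l2Norm x ^ 2| ≤ γ / 2 * l2Norm x ^ 2) ∧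
          (∀ x, IsSparse k x → ∀ u, diffMatrix m ^ r *ᵥ u = Φ ω *ᵥ x →
            √m * ((m : ℝ) / k) ^ (α * ((r : ℝ) - 1 / 2)) / (2 * ((r : ℝ) + 1) ^ 2 * 4 ^ r) *
              l2Norm x ≤ l2Norm u) ∧
          (∀ x, IsSparse k x → ∀ i, |(Φ ω *ᵥ x) i| ≤
            rexp (1 / 2) * √m * ((m : ℝ) / k) ^ (-α / 2) * l2Norm x) ∧
          ((∀ i j, ∀ᵐ ω' ∂P, |Φ ω' i j| ≤ K) → ∀ i j, |Φ ω i j| ≤ K) := by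
  have hτ : (0 : ℝ≥0) < ⟨18 * c ^ 2, by positivity⟩ := by
    have : (0 : ℝ) < 18 * c ^ 2 := by positivity
    exact this
  obtain ⟨c₁, κ₁, hc₁, hκ₁, H₁⟩ := exists_rip_rate.{u} hτ (γ := γ / 2) (by linarith) (by linarith)
  obtain ⟨c₂, κ₂, hc₂, hκ₂, H₂⟩ :=
    exists_rip_rate.{u} hτ (γ := 1 / 2) (by norm_num) (by norm_num)
  have ha' : (1 : ℝ) ≤ a := by exact_mod_cast ha
  -- Half of each of the three rates per unit of `X`, using `m ≥ X`, `l ≥ X / (2 (r + 1))` and the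
  -- tail rate `1 / (4c²)`; the other half pays for entropy.
  set d : ℝ := min (c₁ / 2) (min (c₂ / (4 * (r + 1))) (1 / (8 * c ^ 2))) with hd
  have hd0 : 0 < d := lt_min (by positivity) (lt_min (by positivity) (by positivity))
  have hd1 : d ≤ c₁ / 2 := min_le_left _ _
  have hd2 : d ≤ c₂ / (4 * (r + 1)) := (min_le_right _ _).trans (min_le_left _ _)
  have hd3 : d ≤ 1 / (8 * c ^ 2) := (min_le_right _ _).trans (min_le_right _ _)
  -- The summands secure, in order: `a k ≤ m`, at least one block (`r + 1 ≤ X`), entropy at most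
  -- half the exponent in each of the three events, and `d X / 2 ≥ 1`.
  set C₁ : ℝ := a + (r + 1) + 2 * κ₁ * a / c₁ + 4 * κ₂ * (r + 1) / c₂ + 32 * c ^ 2 + 2 / d with hC₁
  have hp1 : 0 < 2 * κ₁ * a / c₁ := by positivity
  have hp2 : 0 < 4 * κ₂ * (r + 1) / c₂ := by positivity
  have hp3 : 0 < 32 * c ^ 2 := by positivity
  have hp4 : 0 < 2 / d := by positivity
  have hr0 : (0 : ℝ) ≤ r := Nat.cast_nonneg r
  have hC₁0 : 0 < C₁ := by positivity
  refine ⟨C₁, d / 2, hC₁0, by positivity, ?_⟩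
  intro α hα0 hα1 k m N hk hkm hmN hlam Ω _ P _ Φ hΦ K
  have hk0 : (0 : ℝ) < k := by exact_mod_cast hk
  have hk1 : (1 : ℝ) ≤ k := by exact_mod_cast hk
  have hm0 : (0 : ℝ) < m := by exact_mod_cast (hk.trans hkm.le)
  have hmpos : 0 < m := hk.trans_lt' Nat.zero_lt_one |>.trans hkm
  have hkN : k ≤ N := (hkm.trans hmN).le
  have hN0 : (0 : ℝ) < N := by exact_mod_cast hk.trans hkN
  have ha0 : (0 : ℝ) < a := by linarith
  set lam : ℝ := (m : ℝ) / k with hlamdef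
  have hlam1 : 1 ≤ lam := by
    rw [hlamdef, le_div_iff₀ hk0, one_mul]; exact_mod_cast hkm.le
  have hlam0 : 0 < lam := by linarith
  set Lg : ℝ := log (rexp 1 * N / k) with hLg
  have hLg1 : 1 ≤ Lg := one_le_log_exp_mul_div hk hkN
  -- `X = m / λ ^ α = k λ ^ (1 - α)` is, up to constants, the number of blocks of scale `λ ^ α`; the
  -- hypothesis on `λ` says that it dominates the entropy `k log (eN / k)`.
  set X : ℝ := (m : ℝ) ^ (1 - α) * (k : ℝ) ^ α with hX
  obtain ⟨hX1, hXm⟩ : X = k * lam ^ (1 - α) ∧ X * lam ^ α = m := rpow_mul_rpow_eq hm0 hk0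
  have hCL : C₁ * Lg ≤ lam ^ (1 - α) := by
    have h0 : 0 ≤ C₁ * Lg := by positivity
    have := Real.rpow_le_rpow (by positivity) hlam (sub_nonneg.2 hα1.le)
    rwa [← Real.rpow_mul h0, one_div_mul_cancel (by linarith), Real.rpow_one] at this
  set Y : ℝ := k * Lg with hY
  have hY1 : 1 ≤ Y := one_le_mul_of_one_le_of_one_le hk1 hLg1
  have hXY : C₁ * Y ≤ X := by
    rw [hX1, hY, mul_left_comm]; gcongr
  have hβ1 : 1 ≤ lam ^ α := Real.one_le_rpow hlam1 hα0.le
  have hX0 : 0 < X := by rw [hX]; positivity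
  have hXle : X ≤ m := by rw [← hXm]; exact le_mul_of_one_le_right hX0.le hβ1
  have hakN : a * k ≤ N := by
    have h1 : (a : ℝ) * k ≤ m := by
      calc (a : ℝ) * k ≤ C₁ * k := by gcongr; linarith
        _ ≤ C₁ * Y := by
          gcongr; exact le_mul_of_one_le_right hk0.le hLg1
        _ ≤ X := hXY
        _ ≤ m := hXle
    have h2 : a * k ≤ m := by exact_mod_cast h1
    exact h2.trans hmN.le
  have hrX : (r : ℝ) + 1 ≤ X := by
    calc (r : ℝ) + 1 ≤ C₁ * 1 := by linarith
      _ ≤ C₁ * Y := by gcongr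
      _ ≤ X := hXY
  obtain ⟨h, l, hh, hl, hlm, hβh, hXl⟩ := exists_block_sizes hβ1 hXm hrX
  obtain ⟨M, hM1, hM2, hM3⟩ := exists_blockAverage r h l m hh hlm
  have hfam := hΦ.isStdSubgaussianFamily hc
  have E₁ := H₁ Ω P m N (a * k) hmpos (Nat.mul_pos ha hk) hakN Φ hfam
  have E₂ := H₂ Ω P l N k hl hk hkN (fun ω => M * Φ ω) (hfam.matrix_mul M hM1 hM2)
  -- The level `e X` is the square of `exp (1 / 2) √m λ ^ (-α / 2)`.
  have E₃ := hΦ.measureReal_exists_sq_mulVec_gt_le hc hk hkN hmN.le (rexp 1 * X)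
  set B₁ := {ω | ∃ x : Fin N → ℝ, IsSparse (a * k) x ∧
    γ / 2 * l2Norm x ^ 2 < |l2Norm (Φ ω *ᵥ x) ^ 2 / m - l2Norm x ^ 2|}
  set B₂ := {ω | ∃ x : Fin N → ℝ, IsSparse k x ∧
    1 / 2 * l2Norm x ^ 2 < |l2Norm ((M * Φ ω) *ᵥ x) ^ 2 / l - l2Norm x ^ 2|}
  set B₃ := {ω | ∃ x, IsSparse k x ∧ ∃ i, rexp 1 * X * l2Norm x ^ 2 < (Φ ω *ᵥ x) i ^ 2}
  -- The event is fixed before it is known whether `K` bounds the entries. With that assumption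
  -- inside its definition, the exceptional set is null in either case.
  set B₄ := {ω | (∀ i j, ∀ᵐ ω' ∂P, |Φ ω' i j| ≤ K) ∧ ¬ ∀ i j, |Φ ω i j| ≤ K} with hB₄
  have E₄ : P.real B₄ = 0 := by
    by_cases hK : ∀ i j, ∀ᵐ ω' ∂P, |Φ ω' i j| ≤ K
    · have h1 : ∀ᵐ ω ∂P, ∀ i j, |Φ ω i j| ≤ K := ae_all_iff.2 fun i => ae_all_iff.2 (hK i)
      have h2 : P B₄ = 0 := by
        simpa only [hB₄, hK, implies_true, true_and] using ae_iff.1 h1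
      rw [Measure.real, h2, ENNReal.toReal_zero]
    · simp only [hB₄, hK, false_and, Set.ofPred_false, measureReal_empty]
  have F₁ : P.real B₁ ≤ 2 * rexp (-d * X) := by
    refine E₁.trans ?_
    gcongr
    have hak : (((a * k : ℕ) : ℝ) * log (rexp 1 * N / (a * k : ℕ))) ≤ a * Y := by
      push_cast
      rw [hY, mul_assoc]
      refine mul_le_mul_of_nonneg_left (mul_le_mul_of_nonneg_left ?_ hk0.le) (by linarith)
      refine Real.log_le_log (by positivity) ?_
      exact div_le_div_of_nonneg_left (by positivity) hk0 (le_mul_of_one_le_left hk0.le ha')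
    have h1 : 2 * κ₁ * a / c₁ * Y ≤ X := le_trans (by gcongr; linarith) hXY
    rw [div_mul_eq_mul_div, div_le_iff₀ hc₁] at h1
    have h2 := mul_le_mul_of_nonneg_left hak hκ₁.le
    have h3 := mul_le_mul_of_nonneg_left hXle hc₁.le
    have h4 := mul_le_mul_of_nonneg_right hd1 hX0.le
    linarith
  have F₂ : P.real B₂ ≤ 2 * rexp (-d * X) := by
    refine E₂.trans ?_
    gcongr
    have h1 : 4 * κ₂ * (r + 1) / c₂ * Y ≤ X := le_trans (by gcongr; linarith) hXY
    have hr1 : (0 : ℝ) < r + 1 := by linarith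
    have h4 := mul_le_mul_of_nonneg_right hd2 hX0.le
    have h5 : κ₂ * Y ≤ c₂ / (4 * (r + 1)) * X := by
      rw [div_mul_eq_mul_div, div_le_iff₀ hc₂] at h1
      rw [div_mul_eq_mul_div, le_div_iff₀ (by positivity)]
      linarith
    have h6 : c₂ / (4 * (r + 1)) * X * 2 ≤ c₂ * l := by
      rw [div_mul_eq_mul_div, div_mul_eq_mul_div, div_le_iff₀ (by positivity)]
      have := mul_le_mul_of_nonneg_left hXl hc₂.le
      linarith
    linarith
  have F₃ : P.real B₃ ≤ rexp (-d * X) := by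
    refine E₃.trans (exp_le_exp.2 ?_)
    have h1 : 32 * c ^ 2 * Y ≤ X := le_trans (by gcongr; linarith) hXY
    have h2 : X / (4 * c ^ 2) ≤ rexp 1 * X / (4 * c ^ 2) := by
      gcongr
      exact le_mul_of_one_le_left hX0.le (one_le_exp zero_le_one)
    have h3 := mul_le_mul_of_nonneg_right hd3 hX0.le
    have h4 : 4 * Y ≤ 1 / (8 * c ^ 2) * X := by
      rw [div_mul_eq_mul_div, one_mul, le_div_iff₀ (by positivity)]
      linarith
    have h5 : X / (4 * c ^ 2) = 2 * (1 / (8 * c ^ 2) * X) := by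
      field_simp
      norm_num
    linarith
  set B := B₁ ∪ B₂ ∪ B₃ ∪ B₄ with hB
  have hPB : P.real B < 4 * rexp (-(d / 2) * X) := by
    have h1 : P.real B ≤ 5 * rexp (-d * X) := by
      have e1 := measureReal_union_le (μ := P) (B₁ ∪ B₂ ∪ B₃) B₄
      have e2 := measureReal_union_le (μ := P) (B₁ ∪ B₂) B₃
      have e3 := measureReal_union_le (μ := P) B₁ B₂
      linarith
    have h2 : 1 ≤ d / 2 * X := by
      have : 2 / d * 1 ≤ X := le_trans (by gcongr; linarith) hXY
      rw [mul_one, div_le_iff₀ hd0] at this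
      linarith
    rw [neg_mul]
    refine lt_four_mul_exp_of_le_five_mul_exp h2 (h1.trans_eq ?_)
    congr 2
    ring
  -- The bad set quantifies over uncountably many `x`; its measurable hull has the same measure and
  -- avoids any measurability question.
  refine ⟨(toMeasurable P B)ᶜ, (measurableSet_toMeasurable P B).compl, ?_, ?_⟩
  · rw [probReal_compl_eq_one_sub (measurableSet_toMeasurable P B), Measure.real,
      measure_toMeasurable, mul_assoc, ← hX]
    have : (P B).toReal = P.real B := rfl
    linarith
  · intro ω hω
    have hωB : ω ∉ B := fun h => hω (subset_toMeasurable P B h)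
    simp only [hB, Set.mem_union, not_or] at hωB
    obtain ⟨⟨⟨n1, n2⟩, n3⟩, n4⟩ := hωB
    refine ⟨fun x hx => ?_, fun x hx u hu => ?_, fun x hx i => ?_, fun hK => ?_⟩
    · by_contra hcon
      exact n1 ⟨x, hx, not_le.1 hcon⟩
    · refine mul_l2Norm_le_of_blockAverage hh hl hM3 (fun x hx => ?_) ?_ hx hu
      · by_contra hcon
        exact n2 ⟨x, hx, not_le.1 hcon⟩
      · exact sq_lower_bound_le hlam0 hXm hm0.le hβh hXl
    · have h1 : (Φ ω *ᵥ x) i ^ 2 ≤ rexp 1 * X * l2Norm x ^ 2 := by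
        by_contra hcon
        exact n3 ⟨x, hx, i, not_le.1 hcon⟩
      have hx0 := l2Norm_nonneg x
      exact abs_le_of_sq_le_sq (h1.trans_eq (sq_measurement_bound hlam0 hXm hm0.le).symm)
        (by positivity)
    · by_contra hcon
      exact n4 ⟨hK, hcon⟩

end GoodEvent

/-! ### Recovery from quantized measurements -/

theorem theorem4p5 (r : ℕ) (hr : 1 ≤ r) (a : ℕ) (ha : 1 ≤ a) (γ : ℝ) (hγ0 : 0 < γ) (hγ1 : γ < 1)
    (c : ℝ) (hc : 0 < c) (C : ℝ) (hC : 0 < C) :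
    ∃ C₁ C₂ C₃ C₄ : ℝ, 0 < C₁ ∧ 0 < C₂ ∧ 0 < C₃ ∧ 0 < C₄ ∧
      ∀ (α : ℝ), 0 < α → α < 1 →
      ∀ (k m N : ℕ), 1 ≤ k → k < m → m < N →
      (C₁ * Real.log (Real.exp 1 * N / k)) ^ (1 / (1 - α)) ≤ (m : ℝ) / k →
      ∀ (Ω : Type*) [MeasurableSpace Ω] (P : Measure Ω) [IsProbabilityMeasure P]
        (Φ : Ω → Matrix (Fin m) (Fin N) ℝ), IsSubGaussianMatrix P Φ c 0 1 →
      ∀ (Δ : Matrix (Fin m) (Fin N) ℝ → (Fin m → ℝ) → (Fin N → ℝ)), IsRobustDecoder Δ k a γ C →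
      ∀ (δ : ℝ), 0 < δ → ∀ (L : ℕ) (Q : ℝ → ℝ), IsScalarQuantizer δ L Q → ∀ K : ℝ,
      ∃ G : Set Ω, MeasurableSet G ∧
        1 - 4 * Real.exp (-C₂ * (m : ℝ) ^ (1 - α) * (k : ℝ) ^ α) < P.real G ∧
        ∀ ω ∈ G, ∀ z : Fin N → ℝ, IsSparse k z →
          (∀ j ∈ supp z, C₃ * δ < |z j|) →
          -- the number of levels is large enough for the measurements of `z`
          (levelBound r δ ‖Φ ω *ᵥ z‖ ≤ L ∨
            levelBound r δ (Real.exp (1 / 2) * √m * ((m : ℝ) / k) ^ (-α / 2) * l2Norm z) ≤ L ∨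
            (∀ i j, ∀ᵐ ω' ∂P, |Φ ω' i j| ≤ K) ∧
              levelBound r δ (K * √m * ((m : ℝ) / k) ^ (-(1 / 2) : ℝ) * l2Norm z) ≤ L) →
          ∀ q : Fin m → ℝ, q = greedyQuantize Q r (Φ ω *ᵥ z) →
          -- (i) support recovery from the output of the robust decoder
          (∀ w, IsBestTermApprox (supp z).card (Δ ((√m)⁻¹ • Φ ω) ((√m)⁻¹ • q)) w →
            supp w = supp z) ∧
          (∀ w, IsBestTermApprox k (Δ ((√m)⁻¹ • Φ ω) ((√m)⁻¹ • q)) w → supp z ⊆ supp w) ∧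
          -- (ii) accuracy of the Sobolev dual reconstruction on the support
          sobolevDual r (columns (Φ ω) (supp z)) * columns (Φ ω) (supp z) = 1 ∧
          l2Norm ((fun j : supp z => z j) - sobolevDual r (columns (Φ ω) (supp z)) *ᵥ q)
            ≤ C₄ * ((m : ℝ) / k) ^ (-α * ((r : ℝ) - 1 / 2)) * δ := by
  obtain ⟨C₁, C₂, hC₁, hC₂, H⟩ := exists_good_event r a ha hγ0 hγ1 hc
  -- `C₃ δ` is twice the decoder error `C 2 ^ r δ / 2`; `C₄` comes from dividing `√m δ / 2` by the
  -- lower bound `σ`, whose denominator is `2 (r + 1) ^ 2 4 ^ r`.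
  refine ⟨C₁, C₂, C * 2 ^ r, (r + 1) ^ 2 * 4 ^ r, hC₁, hC₂, by positivity, by positivity, ?_⟩
  intro α hα0 hα1 k m N hk hkm hmN hlam Ω _ P _ Φ hΦ Δ hΔ δ hδ L Q hQ K
  obtain ⟨G, hG, hPG, hgood⟩ := H α hα0 hα1 k m N hk hkm hmN hlam Ω P Φ hΦ K
  refine ⟨G, hG, hPG, ?_⟩
  intro ω hω z hz hzlarge hlevel q hq
  obtain ⟨hrip, hlow, hbd, hK⟩ := hgood ω hω
  have hmpos : 0 < m := by omega
  have hNpos : 0 < N := by omega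
  have hk0 : (0 : ℝ) < k := by exact_mod_cast hk
  have hm0 : (0 : ℝ) < m := by exact_mod_cast hmpos
  have hlam0 : (0 : ℝ) < m / k := by positivity
  -- Each alternative supplies a sup-norm bound on the measurements; in the third, `K √k = K √m λ ^
  -- (-1 / 2)`.
  obtain ⟨B, hB, hBL⟩ : ∃ B, (∀ i, |(Φ ω *ᵥ z) i| ≤ B) ∧ levelBound r δ B ≤ L := by
    rcases hlevel with h | h | ⟨h1, h2⟩
    · exact ⟨_, fun i => norm_le_pi_norm (Φ ω *ᵥ z) i, h⟩
    · exact ⟨_, hbd z hz, h⟩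
    · refine ⟨_, fun i => ?_, h2⟩
      have hKω := hK h1
      have hK0 : 0 ≤ K := (abs_nonneg _).trans (hKω i ⟨0, hNpos⟩)
      refine (abs_mulVec_le_of_abs_le (Φ ω) hKω hz hK0 i).trans (le_of_eq ?_)
      rw [Real.rpow_neg hlam0.le, ← Real.sqrt_eq_rpow, Real.sqrt_div hm0.le, inv_div]
      have h3 : √(m : ℝ) ≠ 0 := by positivity
      field_simp
  set u := greedyState Q r (Φ ω *ᵥ z) with hu
  have hub : ∀ i, |u i| ≤ δ / 2 := abs_greedyState_le hδ hQ r hB hBL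
  have hDu : diffMatrix m ^ r *ᵥ u = Φ ω *ᵥ z - q := by
    rw [hq]; exact diffMatrix_pow_mulVec_greedyState Q r _
  have hclose := l2Norm_sub_decoder_le hmpos hNpos hk ha hγ0 hΔ hrip hδ hz hDu hub
  have hlarge : ∀ j ∈ supp z, 2 * (C * (2 ^ r * (δ / 2))) < |z j| := by
    intro j hj
    refine lt_of_eq_of_lt ?_ (hzlarge j hj)
    ring
  set σ : ℝ := √m * ((m : ℝ) / k) ^ (α * ((r : ℝ) - 1 / 2)) / (2 * ((r : ℝ) + 1) ^ 2 * 4 ^ r)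
    with hσ
  have hσ0 : 0 < σ := by positivity
  have hE : ∀ x, σ * l2Norm x ≤
      l2Norm (((diffMatrix m ^ r)⁻¹ * columns (Φ ω) (supp z)) *ᵥ x) := by
    intro x
    -- Extension by zero: the lower bound on the good event is stated for sparse vectors of full
    -- length, which makes it uniform in the support.
    set x' : Fin N → ℝ := fun j => if h : j ∈ supp z then x ⟨j, h⟩ else 0 with hx'
    have hsupp : supp x' ⊆ supp z := by
      intro j hj
      by_contra hjz
      simp only [supp, hx', Finset.mem_filter, Finset.mem_univ, true_and] at hj
      exact hj (dif_neg hjz)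
    have hres : (fun j : supp z => x' j) = x := by
      ext j
      simp [hx']
    have h1 := hlow x' ((Finset.card_le_card hsupp).trans hz)
      (((diffMatrix m ^ r)⁻¹ * columns (Φ ω) (supp z)) *ᵥ x) (by
        rw [Matrix.mulVec_mulVec, ← Matrix.mul_assoc,
          Matrix.mul_nonsing_inv _ (isUnit_det_diffMatrix_pow m r), Matrix.one_mul,
          ← columns_mulVec_restrict (Φ ω) hsupp, hres])
    rwa [← l2Norm_restrict hsupp, hres] at h1
  refine ⟨fun w hw => ?_, fun w hw => ?_, ?_, ?_⟩
  · have hsub := supp_subset_of_isBestTermApprox_of_close hclose hlarge le_rfl hw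
    exact (Finset.eq_of_subset_of_card_le hsub hw.1).symm
  · exact supp_subset_of_isBestTermApprox_of_close hclose hlarge hz hw
  · exact sobolevDual_mul_self hσ0 hE
  · refine (l2Norm_sub_sobolevDual_mulVec_le hσ0 hE (fun j : supp z => z j) q u ?_).trans ?_
    · rw [columns_mulVec_restrict _ (Finset.Subset.refl (supp z))]
      exact hDu
    · have h1 : l2Norm u ≤ √m * (δ / 2) := l2Norm_le_sqrt_mul (by positivity) hub
      rw [div_le_iff₀ hσ0]
      refine h1.trans (le_of_eq ?_)
      rw [hσ, neg_mul, Real.rpow_neg hlam0.le]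
      field_simp
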